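/- Let $\mathbb{R}_+=(0,\infty)$ and let $G=\{(u,v):u\in\mathbb{R},\,v>0\}$ carry the measure $d\nu=v^{-2}\,du\,dv$. For $k\in\{0,1,2,\dots\}$ let $L_k(y)=\sum_{i=0}^{k}(-1)^i\binom{k}{i}\frac{y^i}{i!}$ be the Laguerre polynomial, $\ell_k(y)=e^{-y/2}L_k(y)$, and let $\psi^{(k)}\in L_2(\mathbb{R})$ be the function with Fourier transform $\hat\psi^{(k)}(\xi)=\sqrt{2\xi}\,\ell_k(2\xi)$ for $\xi>0$ and $\hat\psi^{(k)}(\xi)=0$ for $\xi\le 0$, where $\hat g(\xi)=\int_{\mathbb{R}}g(x)e^{-2\pi i x\xi}\,dx$. Put $\psi^{(k)}_v(u)=v^{-1/2}\psi^{(k)}(u/v)$, let $H_2^+(\mathbb{R})=\{h\in L_2(\mathbb{R}):\operatorname{supp}\hat h\subseteq[0,\infty)\}$, and let $A^{(k)}\subseteq L_2(G,d\nu)$ be the (closed) subspace of all functions $(u,v)\mapsto (f*\psi^{(k)}_v)(u)$ with $f\in H_2^+(\mathbb{R})$. For $a\in L_\infty(\mathbb{R}_+)$ let $T_a^{(k)}:A^{(k)}\to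 A^{(k)}$ be the Calderón–Toeplitz operator $T_a^{(k)}F=P^{(k)}(a(v)F)$, where $P^{(k)}$ is the orthogonal projection of $L_2(G,d\nu)$ onto $A^{(k)}$. For a linear subspace $\mathcal{A}$ of $L_\infty(\mathbb{R}_+)$ let $\mathcal{T}_k(\mathcal{A})$ be the $C^*$-algebra of operators on $A^{(k)}$ generated by all $T_a^{(k)}$, $a\in\mathcal{A}$. Finally put $$\gamma_{a,k}(\xi)=\int_{\mathbb{R}_+}a\!\left(\frac{v}{2\xi}\right)\ell_k^2(v)\,dv,\qquad \xi\in\mathbb{R}_+,$$ and $\gamma_{a,k}(0)=\lim_{\xi\to0}\gamma_{a,k}(\xi)$, $\gamma_{a,k}(+\infty)=\lim_{\xi\to+\infty}\gamma_{a,k}(\xi)$ whenever these limits exist, as they do if $a$ has limits at $0$ and $+\infty$. **Theorem.** Let $k\in\{0,1,2,\dots\}$ and let $a_1\in L_\infty(\mathbb{R}_+)$ be a real-valued function that has limits at $0$ and at $+\infty$, such that $\gamma_{a_1,k}$ separates the points of $[0,+\infty]$. Let $L(1,a_1)$ be the linear span of the constant function $1$ and $a_1$. Then the $C^*$-algebra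 $\mathcal{T}_k(L(1,a_1))$ is isometrically $*$-isomorphic to $C[0,+\infty]$, the algebra of complex-valued continuous functions on the compact space $[0,+\infty]$, by an isomorphism $\tau_k:\mathcal{T}_k(L(1,a_1))\to C[0,+\infty]$ with $\tau_k(T_a^{(k)})=\gamma_{a,k}$ on $[0,+\infty]$ for every $a\in L(1,a_1)$. -/

import Mathlib

open MeasureTheory Set Filter Topology FourierTransform
open scoped ENNReal ContDiff

namespace CalderonToeplitz

theorem l2_fourier_mul (f g : Lp ℂ 2 (volume : Measure ℝ)) :
    ∫ x, f x * (𝓕 g : Lp ℂ 2 (volume : Measure ℝ)) x =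
      ∫ x, (𝓕 f : Lp ℂ 2 (volume : Measure ℝ)) x * g x := by
  have key : ∀ (a b : Lp ℂ 2 (volume : Measure ℝ)), ∫ x, a x * b x =
      (ContinuousLinearMap.mul ℂ ℂ).lpPairing volume 2 2 a b := fun a b => by
    rw [ContinuousLinearMap.lpPairing_eq_integral]; rfl
  rw [key, key]
  refine DenseRange.induction_on
    (SchwartzMap.denseRange_toLpCLM (F := ℂ) (μ := (volume : Measure ℝ)) (p := 2) ENNReal.ofNat_ne_top) g
    (isClosed_eq ?_ ?_) ?_
  · exact (ContinuousLinearMap.continuous _).comp (Lp.fourierTransformₗᵢ ℝ ℂ).continuous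
  · exact (ContinuousLinearMap.continuous _)
  intro g
  have := congrArg (fun T => T g) (Lp.fourier_toTemperedDistribution_eq f)
  simp only [TemperedDistribution.fourier_apply, Lp.toTemperedDistribution_apply] at this
  rw [← key, ← key]
  simp only [SchwartzMap.toLpCLM_apply, SchwartzMap.toLp_fourier_eq]
  calc _ = ∫ x, (𝓕 g) x • f x := by
        refine integral_congr_ae ?_
        filter_upwards [(𝓕 g).coeFn_toLp 2 (volume : Measure ℝ)] with x hx
        rw [hx, smul_eq_mul, mul_comm]
    _ = _ := this
    _ = _ := by
        refine integral_congr_ae ?_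
        filter_upwards [g.coeFn_toLp 2 (volume : Measure ℝ)] with x hx
        rw [hx, smul_eq_mul, mul_comm]

theorem l1l2_fourier_ae {h : ℝ → ℂ} (h1 : Integrable h) (h2 : MemLp h 2) :
    (𝓕 (h2.toLp h) : Lp ℂ 2 (volume : Measure ℝ)) =ᵐ[volume] 𝓕 h := by
  have hc : Continuous (𝓕 h) :=
    VectorFourier.fourierIntegral_continuous Real.continuous_fourierChar
      (by exact continuous_inner) h1
  refine ae_eq_of_integral_contDiff_smul_eq ?_ hc.locallyIntegrable ?_
  · exact (Lp.memLp (𝓕 (h2.toLp h) : Lp ℂ 2 (volume : Measure ℝ))).locallyIntegrable (by norm_num)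
  intro g gd gs
  have gd' : ContDiff ℝ ∞ (fun x => (g x : ℂ)) := Complex.ofRealCLM.contDiff.comp gd
  have gs' : HasCompactSupport (fun x => (g x : ℂ)) := gs.comp_left (g := fun x : ℝ => (x : ℂ)) (by simp)
  set G := gs'.toSchwartzMap gd' with hG
  have hGx : ∀ x, G x = (g x : ℂ) := fun x => rfl
  have := congrArg (fun T => T G) (Lp.fourier_toTemperedDistribution_eq (h2.toLp h))
  simp only [TemperedDistribution.fourier_apply, Lp.toTemperedDistribution_apply] at this
  have e1 : ∫ x, g x • (𝓕 (h2.toLp h) : Lp ℂ 2 (volume : Measure ℝ)) x = 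
     ∫ x, G x • (𝓕 (h2.toLp h) : Lp ℂ 2 (volume : Measure ℝ)) x := by
    refine integral_congr_ae (.of_forall fun x => ?_)
    simp [hGx]
  rw [e1, ← this]
  have e2 : ∫ x, (𝓕 G) x • (h2.toLp h) x = ∫ x, (𝓕 G) x • h x := by
    refine integral_congr_ae ?_
    filter_upwards [h2.coeFn_toLp] with x hx
    rw [hx]
  rw [e2]
  have e3 := VectorFourier.integral_fourierIntegral_smul_eq_flip (L := innerₗ ℝ) 
    (μ := volume) (ν := volume) Real.continuous_fourierChar (by exact continuous_inner) G.integrable h1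
  rw [flip_innerₗ] at e3
  refine Eq.trans e3 ?_
  refine integral_congr_ae (.of_forall fun x => ?_)
  simp only [hGx, Complex.real_smul, smul_eq_mul]
  rfl

/-- The Laguerre polynomial `L_k`. -/
noncomputable def laguerrePoly (k : ℕ) (y : ℝ) : ℝ :=
  ∑ i ∈ Finset.range (k + 1), (-1) ^ i * (k.choose i : ℝ) * y ^ i / (i.factorial : ℝ)

/-- The Laguerre function `ℓ_k(y) = e^{-y/2} L_k(y)`. -/
noncomputable def laguerreFun (k : ℕ) (y : ℝ) : ℝ := Real.exp (-y / 2) * laguerrePoly k y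

/-- The Fourier transform of the wavelet `ψ^{(k)}`: `χ_+(ξ) √(2ξ) ℓ_k(2ξ)`. -/
noncomputable def waveletHat (k : ℕ) (ξ : ℝ) : ℂ :=
  if 0 < ξ then ((√(2 * ξ) * laguerreFun k (2 * ξ) : ℝ) : ℂ) else 0

/-- The wavelet `ψ^{(k)}`, as the inverse Fourier integral of `waveletHat k`
(which is integrable and square integrable). -/
noncomputable def wavelet (k : ℕ) : ℝ → ℂ := 𝓕⁻ (waveletHat k)

/-- The dilation `ψ_v(u) = v^{-1/2} ψ(u/v)`. -/
noncomputable def dilate (ψ : ℝ → ℂ) (v : ℝ) (u : ℝ) : ℂ := ((√v)⁻¹ : ℝ) * ψ (u / v)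

/-- The wavelet transform `(W_k f)(u,v) = (f * ψ_v^{(k)})(u)`. -/
noncomputable def waveletTransform (k : ℕ) (f : ℝ → ℂ) (p : ℝ × ℝ) : ℂ :=
  convolution f (dilate (wavelet k) p.2) (ContinuousLinearMap.mul ℂ ℂ) volume p.1

theorem continuous_laguerrePoly (k : ℕ) : Continuous (laguerrePoly k) := by
  unfold laguerrePoly; fun_prop

theorem continuous_laguerreFun (k : ℕ) : Continuous (laguerreFun k) := by
  unfold laguerreFun
  exact (by fun_prop : Continuous fun y : ℝ => Real.exp (-y / 2)).mul (continuous_laguerrePoly k)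

theorem laguerrePoly_bound (k : ℕ) :
    ∃ C : ℝ, 0 ≤ C ∧ ∀ y, 0 ≤ y → |laguerrePoly k y| ≤ C * Real.exp (y / 8) := by
  refine ⟨∑ i ∈ Finset.range (k + 1), (k.choose i : ℝ) * 8 ^ i, by positivity, fun y hy => ?_⟩
  unfold laguerrePoly
  rw [Finset.sum_mul]
  refine (Finset.abs_sum_le_sum_abs _ _).trans (Finset.sum_le_sum fun i _ => ?_)
  have h := Real.pow_div_factorial_le_exp (y / 8) (by positivity) i
  have : |(-1 : ℝ) ^ i * (k.choose i : ℝ) * y ^ i / (i.factorial : ℝ)| =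
      (k.choose i : ℝ) * 8 ^ i * ((y / 8) ^ i / (i.factorial : ℝ)) := by
    rw [abs_div, abs_mul, abs_mul, abs_pow, abs_neg, abs_one, one_pow, one_mul, Nat.abs_cast,
      abs_of_nonneg (by positivity : 0 ≤ y ^ i), Nat.abs_cast, div_pow]
    field_simp
  rw [this]
  gcongr

theorem laguerreFun_bound (k : ℕ) :
    ∃ C : ℝ, 0 ≤ C ∧ ∀ y, 0 ≤ y → |laguerreFun k y| ≤ C * Real.exp (-3 / 8 * y) := by
  obtain ⟨C, hC, h⟩ := laguerrePoly_bound k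
  refine ⟨C, hC, fun y hy => ?_⟩
  unfold laguerreFun
  rw [abs_mul, Real.abs_exp]
  calc _ ≤ Real.exp (-y / 2) * (C * Real.exp (y / 8)) := by gcongr; exact h y hy
    _ = _ := by
      rw [mul_left_comm, ← Real.exp_add]; ring_nf

theorem waveletHat_bound (k : ℕ) :
    ∃ C : ℝ, 0 ≤ C ∧ ∀ ξ, ‖waveletHat k ξ‖ ≤
      (Ioi (0 : ℝ)).indicator (fun ξ => C * Real.exp (-(1 / 2) * ξ)) ξ := by
  obtain ⟨C, hC, h⟩ := laguerreFun_bound k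
  refine ⟨8 * C, by positivity, fun ξ => ?_⟩
  unfold waveletHat
  split_ifs with hξ
  · rw [indicator_of_mem (by exact hξ), Complex.norm_real, Real.norm_eq_abs, abs_mul,
      abs_of_nonneg (Real.sqrt_nonneg _)]
    have h1 : √(2 * ξ) ≤ 8 * Real.exp (2 * ξ / 8) := by
      have := Real.add_one_le_exp (2 * ξ / 8)
      have h2 : √(2 * ξ) ≤ 1 + 2 * ξ := by
        rw [Real.sqrt_le_left (by positivity)]; nlinarith
      linarith
    calc _ ≤ (8 * Real.exp (2 * ξ / 8)) * (C * Real.exp (-3 / 8 * (2 * ξ))) := by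
          gcongr; exact h _ (by positivity)
      _ = 8 * C * (Real.exp (2 * ξ / 8) * Real.exp (-3 / 8 * (2 * ξ))) := by ring
      _ = _ := by rw [← Real.exp_add]; ring_nf
  · rw [indicator_of_notMem (by simpa using hξ)]; simp

theorem measurable_waveletHat (k : ℕ) : Measurable (waveletHat k) := by
  unfold waveletHat
  refine Measurable.ite measurableSet_Ioi ?_ measurable_const
  have := (continuous_laguerreFun k).measurable
  fun_prop

theorem integrable_waveletHat (k : ℕ) : Integrable (waveletHat k) := by
  obtain ⟨C, hC, h⟩ := waveletHat_bound k
  refine Integrable.mono' (g := (Ioi (0 : ℝ)).indicator (fun ξ => C * Real.exp (-(1 / 2) * ξ)))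
    ?_ (measurable_waveletHat k).aestronglyMeasurable (.of_forall h)
  rw [integrable_indicator_iff measurableSet_Ioi]
  exact (exp_neg_integrableOn_Ioi 0 (by norm_num : (0 : ℝ) < 1 / 2)).const_mul C

theorem waveletHat_bdd (k : ℕ) : ∃ C : ℝ, ∀ ξ, ‖waveletHat k ξ‖ ≤ C := by
  obtain ⟨C, hC, h⟩ := waveletHat_bound k
  refine ⟨C, fun ξ => (h ξ).trans ?_⟩
  refine indicator_apply_le' (fun hξ => ?_) (fun _ => hC)
  have : Real.exp (-(1 / 2) * ξ) ≤ 1 := Real.exp_le_one_iff.2 (by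
    have : 0 < ξ := hξ
    linarith)
  nlinarith

theorem memLp_two_of_bdd {h : ℝ → ℂ} (h1 : Integrable h) {C : ℝ} (hC : ∀ ξ, ‖h ξ‖ ≤ C) :
    MemLp h 2 := by
  rw [memLp_two_iff_integrable_sq_norm h1.aestronglyMeasurable]
  refine (h1.norm.const_mul C).mono' (h1.aestronglyMeasurable.norm.pow 2) (.of_forall fun x => ?_)
  rw [Real.norm_eq_abs, abs_of_nonneg (by positivity), sq]
  exact mul_le_mul_of_nonneg_right (hC x) (norm_nonneg _)

theorem continuous_wavelet (k : ℕ) : Continuous (wavelet k) := by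
  have : Continuous (𝓕 (waveletHat k)) :=
    VectorFourier.fourierIntegral_continuous Real.continuous_fourierChar
      (by exact continuous_inner) (integrable_waveletHat k)
  unfold wavelet
  have h2 : 𝓕⁻ (waveletHat k) = fun x => 𝓕 (waveletHat k) (-x) := by
    ext x; exact Real.fourierInv_eq_fourier_neg _ _
  rw [h2]; exact this.comp continuous_neg

/-- The function whose Fourier transform is `x ↦ ψ_v(u - x)`. -/
noncomputable def kernelHat (k : ℕ) (u v ξ : ℝ) : ℂ :=
  (√v : ℂ) * waveletHat k (v * ξ) * Complex.exp (2 * Real.pi * u * ξ * Complex.I)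

theorem norm_kernelHat (k : ℕ) (u v ξ : ℝ) :
    ‖kernelHat k u v ξ‖ = √v * ‖waveletHat k (v * ξ)‖ := by
  unfold kernelHat
  rw [norm_mul, norm_mul, Complex.norm_real, Real.norm_eq_abs, abs_of_nonneg (Real.sqrt_nonneg _)]
  have : (2 * Real.pi * u * ξ * Complex.I : ℂ) = ((2 * Real.pi * u * ξ : ℝ) : ℂ) * Complex.I := by
    push_cast; ring
  rw [this, Complex.norm_exp_ofReal_mul_I, mul_one]

theorem measurable_kernelHat (k : ℕ) (u v : ℝ) : Measurable (kernelHat k u v) := by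
  unfold kernelHat
  have := measurable_waveletHat k
  fun_prop

theorem integrable_kernelHat (k : ℕ) (u : ℝ) {v : ℝ} (hv : 0 < v) :
    Integrable (kernelHat k u v) := by
  refine (((integrable_waveletHat k).comp_mul_left' hv.ne').norm.const_mul (√v)).mono'
    (measurable_kernelHat k u v).aestronglyMeasurable (.of_forall fun ξ => ?_)
  rw [norm_kernelHat]

theorem memLp_kernelHat (k : ℕ) (u : ℝ) {v : ℝ} (hv : 0 < v) :
    MemLp (kernelHat k u v) 2 := by
  obtain ⟨C, hC⟩ := waveletHat_bdd k
  refine memLp_two_of_bdd (integrable_kernelHat k u hv) (C := √v * C) fun ξ => ?_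
  rw [norm_kernelHat]
  exact mul_le_mul_of_nonneg_left (hC _) (Real.sqrt_nonneg _)

theorem dilate_wavelet_eq (k : ℕ) (u x : ℝ) {v : ℝ} (hv : 0 < v) :
    dilate (wavelet k) v (u - x) = 𝓕 (kernelHat k u v) x := by
  unfold dilate wavelet
  rw [Real.fourierInv_eq', Real.fourier_eq']
  have := Measure.integral_comp_mul_left (fun ξ : ℝ =>
    Complex.exp (((2 * Real.pi * inner ℝ ξ ((u - x) / v) : ℝ) : ℂ) * Complex.I) • waveletHat k ξ) v
  have h2 : ∫ ξ : ℝ, Complex.exp (((2 * Real.pi * inner ℝ ξ ((u - x) / v) : ℝ) : ℂ) * Complex.I)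
      • waveletHat k ξ = (v : ℂ) * ∫ ξ : ℝ, Complex.exp (((2 * Real.pi * inner ℝ (v * ξ) ((u - x) / v) : ℝ) : ℂ)
        * Complex.I) • waveletHat k (v * ξ) := by
    rw [this, abs_of_pos (inv_pos.2 hv), Complex.real_smul, ← mul_assoc]
    push_cast
    rw [mul_inv_cancel₀ (by exact_mod_cast hv.ne'), one_mul]
  rw [h2, ← mul_assoc, ← integral_const_mul]
  refine integral_congr_ae (.of_forall fun ξ => ?_)
  simp only [kernelHat, smul_eq_mul]
  have h3 : (((√v)⁻¹ : ℝ) : ℂ) * v = (√v : ℂ) := by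
    rw [← Complex.ofReal_mul]
    congr 1
    rw [inv_mul_eq_div, Real.div_sqrt]
  have h4 : Complex.exp (((2 * Real.pi * inner ℝ (v * ξ) ((u - x) / v) : ℝ) : ℂ) * Complex.I) =
      Complex.exp (((-2 * Real.pi * inner ℝ ξ x : ℝ) : ℂ) * Complex.I) *
        Complex.exp (2 * Real.pi * u * ξ * Complex.I) := by
    rw [← Complex.exp_add]
    congr 1
    simp only [RCLike.inner_apply, conj_trivial]
    have : (v : ℂ) ≠ 0 := by exact_mod_cast hv.ne'
    push_cast
    field_simp
    ring
  rw [h3, h4]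
  ring

/-- `W_k f (u, v)` as an inverse Fourier integral. -/
theorem waveletTransform_eq (k : ℕ) (f : Lp ℂ 2 (volume : Measure ℝ)) (u : ℝ) {v : ℝ}
    (hv : 0 < v) :
    waveletTransform k f (u, v) =
      ∫ ξ, (𝓕 f : Lp ℂ 2 (volume : Measure ℝ)) ξ * kernelHat k u v ξ := by
  unfold waveletTransform convolution
  simp only [ContinuousLinearMap.mul_apply']
  have h2 := memLp_kernelHat k u hv
  calc _ = ∫ x, f x * (𝓕 (h2.toLp _) : Lp ℂ 2 (volume : Measure ℝ)) x := by
        refine integral_congr_ae ?_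
        filter_upwards [l1l2_fourier_ae (integrable_kernelHat k u hv) h2] with x hx
        rw [hx, dilate_wavelet_eq k u x hv]
    _ = _ := l2_fourier_mul f _
    _ = _ := by
        refine integral_congr_ae ?_
        filter_upwards [h2.coeFn_toLp] with x hx
        rw [hx]

/-- The Hardy space `H_2^+(ℝ)`: square-integrable `h` with `supp ĥ ⊆ [0, ∞)`. -/
noncomputable def hardySpace : Submodule ℂ (Lp ℂ 2 (volume : Measure ℝ)) where
  carrier := {h | ∀ᵐ ξ ∂(volume : Measure ℝ), ξ < 0 →
    (𝓕 h : Lp ℂ 2 (volume : Measure ℝ)) ξ = 0}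
  add_mem' := by
    intro f g hf hg
    have : (𝓕 (f + g) : Lp ℂ 2 (volume : Measure ℝ)) = 𝓕 f + 𝓕 g :=
      (Lp.fourierTransformₗᵢ ℝ ℂ).map_add f g
    simp only [mem_ofPred_eq] at *
    rw [this]
    filter_upwards [hf, hg, Lp.coeFn_add (𝓕 f : Lp ℂ 2 (volume : Measure ℝ)) (𝓕 g)]
      with ξ h1 h2 h3 hξ
    rw [h3, Pi.add_apply, h1 hξ, h2 hξ, add_zero]
  zero_mem' := by
    have : (𝓕 (0 : Lp ℂ 2 (volume : Measure ℝ)) : Lp ℂ 2 (volume : Measure ℝ)) = 0 :=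
      (Lp.fourierTransformₗᵢ ℝ ℂ).map_zero
    simp only [mem_ofPred_eq]
    rw [this]
    filter_upwards [Lp.coeFn_zero ℂ 2 (volume : Measure ℝ)] with ξ h _
    exact h
  smul_mem' := by
    intro c f hf
    have : (𝓕 (c • f) : Lp ℂ 2 (volume : Measure ℝ)) = c • 𝓕 f :=
      (Lp.fourierTransformₗᵢ ℝ ℂ).map_smul c f
    simp only [mem_ofPred_eq] at *
    rw [this]
    filter_upwards [hf, Lp.coeFn_smul c (𝓕 f : Lp ℂ 2 (volume : Measure ℝ))] with ξ h1 h2 hξ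
    rw [h2, Pi.smul_apply, h1 hξ, smul_zero]

/-- Lebesgue measure on `ℝ_+ = (0, ∞)`. -/
noncomputable abbrev halfLine : Measure ℝ := volume.restrict (Ioi 0)

/-- The left Haar measure `dν = v^{-2} du dv` of `G = {(u, v) : u ∈ ℝ, v > 0}`, as a measure on
`ℝ × ℝ` carried by `G`. -/
noncomputable def haarG : Measure (ℝ × ℝ) :=
  volume.prod (halfLine.withDensity fun v => ENNReal.ofReal (1 / v ^ 2))

theorem measurable_waveletTransform (k : ℕ) (f : Lp ℂ 2 (volume : Measure ℝ)) :
    StronglyMeasurable (waveletTransform k f) := by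
  unfold waveletTransform convolution dilate
  simp only [ContinuousLinearMap.mul_apply']
  refine StronglyMeasurable.integral_prod_right' (ν := (volume : Measure ℝ))
    (f := fun q : (ℝ × ℝ) × ℝ => f q.2 * ((((√q.1.2)⁻¹ : ℝ) : ℂ) *
      wavelet k ((q.1.1 - q.2) / q.1.2))) ?_
  have hf := (Lp.stronglyMeasurable f).measurable
  have hw := (continuous_wavelet k).measurable
  exact Measurable.stronglyMeasurable (by fun_prop)

theorem lintegral_fourier_sq {h : ℝ → ℂ} (h1 : Integrable h) (h2 : MemLp h 2) :
    ∫⁻ x, ‖𝓕 h x‖ₑ ^ (2 : ℝ) = ∫⁻ x, ‖h x‖ₑ ^ (2 : ℝ) := by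
  have e := Lp.norm_fourier_eq (h2.toLp h)
  have e2 : ‖(𝓕 (h2.toLp h) : Lp ℂ 2 (volume : Measure ℝ))‖ₑ = ‖h2.toLp h‖ₑ := by
    rw [← ofReal_norm, e, ofReal_norm]
  rw [Lp.enorm_def, Lp.enorm_def, eLpNorm_congr_ae (l1l2_fourier_ae h1 h2),
    eLpNorm_congr_ae h2.coeFn_toLp] at e2
  have a := eLpNorm_nnreal_pow_eq_lintegral (f := 𝓕 h) (μ := (volume : Measure ℝ)) (p := 2)
    (by norm_num)
  have b := eLpNorm_nnreal_pow_eq_lintegral (f := h) (μ := (volume : Measure ℝ)) (p := 2)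
    (by norm_num)
  simp only [NNReal.coe_ofNat, ENNReal.coe_ofNat] at a b
  rw [← a, ← b, e2]

theorem waveletTransform_slice (k : ℕ) (f : Lp ℂ 2 (volume : Measure ℝ)) {v : ℝ} (hv : 0 < v) :
    ∫⁻ u, ‖waveletTransform k f (u, v)‖ₑ ^ (2 : ℝ) =
      ∫⁻ ξ, ‖(𝓕 f : Lp ℂ 2 (volume : Measure ℝ)) ξ‖ₑ ^ (2 : ℝ) *
        ‖kernelHat k 0 v ξ‖ₑ ^ (2 : ℝ) := by
  set φ : Lp ℂ 2 (volume : Measure ℝ) := 𝓕 f with hφ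
  set h : ℝ → ℂ := fun ξ => φ ξ * kernelHat k 0 v ξ with hh
  have h1 : Integrable h := (Lp.memLp φ).integrable_mul (memLp_kernelHat k 0 hv)
  have h2 : MemLp h 2 := by
    obtain ⟨C, hC⟩ := waveletHat_bdd k
    refine ((Lp.memLp φ).norm.const_mul (√v * C)).mono' h1.aestronglyMeasurable
      (.of_forall fun ξ => ?_)
    rw [hh, norm_mul, norm_kernelHat, mul_comm]
    gcongr
    exact hC _
  have e : ∀ u, waveletTransform k f (u, v) = 𝓕 h (-u) := by
    intro u
    rw [waveletTransform_eq k f u hv, Real.fourier_eq']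
    refine integral_congr_ae (.of_forall fun ξ => ?_)
    simp only [hh, smul_eq_mul, kernelHat, RCLike.inner_apply, conj_trivial, Complex.ofReal_zero,
      mul_zero, zero_mul, Complex.exp_zero, mul_one]
    have : ((-2 * Real.pi * (-u * ξ) : ℝ) : ℂ) * Complex.I = 2 * Real.pi * u * ξ * Complex.I := by
      push_cast; ring
    rw [this]
    ring
  simp_rw [e]
  rw [lintegral_neg_eq_self (fun x => ‖𝓕 h x‖ₑ ^ (2 : ℝ)) (μ := volume), lintegral_fourier_sq h1 h2]
  simp_rw [hh, enorm_mul, ENNReal.mul_rpow_of_nonneg _ _ (by norm_num : (0 : ℝ) ≤ 2)]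

/-- `∫_0^∞ ℓ_k^2`. -/
noncomputable def laguerreMass (k : ℕ) : ℝ≥0∞ :=
  ∫⁻ t in Ioi (0 : ℝ), ENNReal.ofReal (laguerreFun k t ^ 2)

theorem integrable_laguerre_sq (k : ℕ) :
    IntegrableOn (fun t => laguerreFun k t ^ 2) (Ioi (0 : ℝ)) := by
  obtain ⟨C, hC, h⟩ := laguerreFun_bound k
  refine Integrable.mono' (g := fun t => C ^ 2 * Real.exp (-(3 / 4) * t))
    ((exp_neg_integrableOn_Ioi 0 (by norm_num : (0 : ℝ) < 3 / 4)).const_mul (C ^ 2))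
    ((continuous_laguerreFun k).pow 2).aestronglyMeasurable ?_
  filter_upwards [ae_restrict_mem measurableSet_Ioi] with t ht
  rw [Real.norm_eq_abs, abs_pow]
  calc _ ≤ (C * Real.exp (-3 / 8 * t)) ^ 2 := by gcongr; exact h t (le_of_lt ht)
    _ = _ := by rw [mul_pow, sq (Real.exp _), ← Real.exp_add]; ring_nf

theorem laguerreMass_ne_top (k : ℕ) : laguerreMass k ≠ ⊤ := by
  unfold laguerreMass
  rw [← ofReal_integral_eq_lintegral_ofReal (integrable_laguerre_sq k)
    (.of_forall fun t => sq_nonneg _)]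
  exact ENNReal.ofReal_ne_top

theorem laguerreFun_zero (k : ℕ) : laguerreFun k 0 = 1 := by
  unfold laguerreFun laguerrePoly
  rw [Finset.sum_eq_single 0] <;> simp +contextual

theorem laguerreMass_ne_zero (k : ℕ) : laguerreMass k ≠ 0 := by
  unfold laguerreMass
  intro h
  rw [lintegral_eq_zero_iff (by have := (continuous_laguerreFun k).measurable; fun_prop)] at h
  have h2 : (laguerreFun k) =ᵐ[volume.restrict (Ioi 0)] fun _ => 0 := by
    filter_upwards [h] with t ht
    have ht' : ENNReal.ofReal (laguerreFun k t ^ 2) = 0 := ht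
    rw [ENNReal.ofReal_eq_zero] at ht'
    exact pow_eq_zero_iff (by norm_num) |>.1 (le_antisymm ht' (sq_nonneg _))
  have h3 : EqOn (laguerreFun k) (fun _ => 0) (Ioi 0) :=
    Measure.eqOn_open_of_ae_eq h2 isOpen_Ioi (continuous_laguerreFun k).continuousOn
      continuousOn_const
  have h4 := h3.closure (continuous_laguerreFun k) continuous_const
  rw [closure_Ioi] at h4
  have := h4 (self_mem_Ici (a := (0 : ℝ)))
  rw [laguerreFun_zero] at this
  norm_num at this

theorem lintegral_kernelHat (k : ℕ) {ξ : ℝ} (hξ : 0 < ξ) :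
    ∫⁻ v, ‖kernelHat k 0 v ξ‖ₑ ^ (2 : ℝ) ∂(halfLine.withDensity fun v => ENNReal.ofReal (1 / v ^ 2))
      = laguerreMass k := by
  rw [lintegral_withDensity_eq_lintegral_mul₀ (by fun_prop)]
  · have e : ∫⁻ v in Ioi (0 : ℝ), ((fun v : ℝ => ENNReal.ofReal (1 / v ^ 2)) *
        fun v => ‖kernelHat k 0 v ξ‖ₑ ^ (2 : ℝ)) v =
        ∫⁻ v in Ioi (0 : ℝ), ENNReal.ofReal (2 * ξ * laguerreFun k (2 * ξ * v) ^ 2) := by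
      refine setLIntegral_congr_fun measurableSet_Ioi fun v (hv : 0 < v) => ?_
      simp only [Pi.mul_apply]
      rw [← ofReal_norm, norm_kernelHat, waveletHat, if_pos (by positivity), Complex.norm_real,
        ENNReal.ofReal_rpow_of_nonneg (by positivity) (by norm_num),
        ← ENNReal.ofReal_mul (by positivity)]
      congr 1
      rw [show (2 : ℝ) = ((2 : ℕ) : ℝ) by norm_num, Real.rpow_natCast, mul_pow, Real.norm_eq_abs,
        sq_abs, mul_pow, Real.sq_sqrt hv.le, Real.sq_sqrt (by positivity)]
      push_cast
      rw [show 2 * ξ * v = 2 * (v * ξ) by ring]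
      field_simp
    rw [e, laguerreMass, ← ofReal_integral_eq_lintegral_ofReal _
      (.of_forall fun v => by positivity), ← ofReal_integral_eq_lintegral_ofReal
      (integrable_laguerre_sq k) (.of_forall fun t => sq_nonneg _)]
    · congr 1
      rw [integral_const_mul, integral_comp_mul_left_Ioi (fun t => laguerreFun k t ^ 2) 0
        (by positivity : 0 < 2 * ξ), mul_zero, smul_eq_mul, mul_inv_cancel_left₀ (by positivity)]
    · refine Integrable.const_mul ?_ _
      have := (integrableOn_Ioi_comp_mul_left_iff (fun t => laguerreFun k t ^ 2) 0
        (by positivity : 0 < 2 * ξ)).2 (by rw [mul_zero]; exact integrable_laguerre_sq k)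
      exact this
  · unfold kernelHat
    have := measurable_waveletHat k
    fun_prop

theorem measurable_kernelHat_uncurry (k : ℕ) :
    Measurable fun q : ℝ × ℝ => kernelHat k 0 q.1 q.2 := by
  unfold kernelHat
  have := measurable_waveletHat k
  fun_prop

theorem lintegral_waveletTransform (k : ℕ) (f : hardySpace) :
    ∫⁻ p, ‖waveletTransform k (f : Lp ℂ 2 (volume : Measure ℝ)) p‖ₑ ^ (2 : ℝ) ∂haarG =
      laguerreMass k * ‖f‖ₑ ^ (2 : ℝ) := by
  obtain ⟨f, hf⟩ := f
  set φ : Lp ℂ 2 (volume : Measure ℝ) := 𝓕 f with hφ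
  have hm := (measurable_waveletTransform k f).measurable
  have hφm := (Lp.stronglyMeasurable φ).measurable
  have hkm := measurable_kernelHat_uncurry k
  unfold haarG
  rw [lintegral_prod_symm _ (by fun_prop)]
  have e1 : ∀ᵐ v ∂(halfLine.withDensity fun v => ENNReal.ofReal (1 / v ^ 2)),
      ∫⁻ u, ‖waveletTransform k f (u, v)‖ₑ ^ (2 : ℝ) =
      ∫⁻ ξ, ‖φ ξ‖ₑ ^ (2 : ℝ) * ‖kernelHat k 0 v ξ‖ₑ ^ (2 : ℝ) := by
    refine (withDensity_absolutelyContinuous _ _).ae_le ?_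
    filter_upwards [ae_restrict_mem measurableSet_Ioi] with v hv
    exact waveletTransform_slice k f hv
  rw [lintegral_congr_ae e1, lintegral_lintegral_swap (by fun_prop)]
  have e2 : ∀ᵐ ξ ∂(volume : Measure ℝ),
      ∫⁻ v, ‖φ ξ‖ₑ ^ (2 : ℝ) * ‖kernelHat k 0 v ξ‖ₑ ^ (2 : ℝ)
        ∂(halfLine.withDensity fun v => ENNReal.ofReal (1 / v ^ 2)) =
      ‖φ ξ‖ₑ ^ (2 : ℝ) * laguerreMass k := by
    have h0 : ∀ᵐ ξ ∂(volume : Measure ℝ), ξ ≠ 0 := by simp [ae_iff]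
    filter_upwards [hf, h0] with ξ h1 h2
    rw [lintegral_const_mul _ (by fun_prop)]
    rcases lt_or_gt_of_ne h2 with h | h
    · rw [hφ, h1 h]; simp
    · rw [lintegral_kernelHat k h]
  rw [lintegral_congr_ae e2, lintegral_mul_const _ (by fun_prop), mul_comm]
  congr 1
  have e3 : ‖φ‖ₑ = ‖f‖ₑ := by
    rw [← ofReal_norm, hφ, Lp.norm_fourier_eq, ofReal_norm]
  have b := eLpNorm_nnreal_pow_eq_lintegral (f := φ) (μ := (volume : Measure ℝ)) (p := 2)
    (by norm_num)
  simp only [NNReal.coe_ofNat, ENNReal.coe_ofNat] at b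
  rw [← b, ← Lp.enorm_def, e3]
  rfl

theorem eLpNorm_waveletTransform (k : ℕ) (f : hardySpace) :
    eLpNorm (waveletTransform k (f : Lp ℂ 2 (volume : Measure ℝ))) 2 haarG =
      laguerreMass k ^ (1 / 2 : ℝ) * ‖f‖ₑ := by
  have b := eLpNorm_nnreal_pow_eq_lintegral
    (f := waveletTransform k (f : Lp ℂ 2 (volume : Measure ℝ))) (μ := haarG) (p := 2) (by norm_num)
  simp only [NNReal.coe_ofNat, ENNReal.coe_ofNat] at b
  rw [lintegral_waveletTransform] at b
  have c := congrArg (fun x : ℝ≥0∞ => x ^ (1 / 2 : ℝ)) b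
  simp only [ENNReal.mul_rpow_of_nonneg _ _ (by norm_num : (0 : ℝ) ≤ 1 / 2), ← ENNReal.rpow_mul]
    at c
  norm_num at c ⊢
  exact c

theorem memLp_waveletTransform (k : ℕ) (f : hardySpace) :
    MemLp (waveletTransform k (f : Lp ℂ 2 (volume : Measure ℝ))) 2 haarG := by
  refine ⟨(measurable_waveletTransform k _).aestronglyMeasurable, ?_⟩
  rw [eLpNorm_waveletTransform]
  exact ENNReal.mul_lt_top (ENNReal.rpow_lt_top_of_nonneg (by norm_num) (laguerreMass_ne_top k))
    enorm_lt_top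

theorem ae_haarG_pos : ∀ᵐ p ∂haarG, 0 < p.2 := by
  have h : ∀ᵐ v ∂(halfLine.withDensity fun v => ENNReal.ofReal (1 / v ^ 2)), 0 < v :=
    (withDensity_absolutelyContinuous _ _).ae_le (ae_restrict_mem measurableSet_Ioi)
  exact Measure.quasiMeasurePreserving_snd.ae h

/-- The continuous wavelet transform `W_k : H_2^+(ℝ) → L_2(G, dν)`. -/
noncomputable def waveletMap (k : ℕ) : hardySpace →ₗ[ℂ] Lp ℂ 2 haarG where
  toFun f := (memLp_waveletTransform k f).toLp _
  map_add' := by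
    intro f g
    rw [← MemLp.toLp_add]
    refine MemLp.toLp_congr _ _ ?_
    filter_upwards [ae_haarG_pos] with ⟨u, v⟩ hv
    have e : (𝓕 ((f + g : hardySpace) : Lp ℂ 2 (volume : Measure ℝ)) : Lp ℂ 2 (volume : Measure ℝ))
      = 𝓕 (f : Lp ℂ 2 (volume : Measure ℝ)) + 𝓕 (g : Lp ℂ 2 (volume : Measure ℝ)) :=
      (Lp.fourierTransformₗᵢ ℝ ℂ).map_add _ _
    rw [Pi.add_apply, waveletTransform_eq k _ u hv, waveletTransform_eq k _ u hv,
      waveletTransform_eq k _ u hv, e, ← integral_add]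
    · refine integral_congr_ae ?_
      filter_upwards [Lp.coeFn_add (𝓕 (f : Lp ℂ 2 (volume : Measure ℝ)) : Lp ℂ 2 (volume : Measure ℝ))
        (𝓕 (g : Lp ℂ 2 (volume : Measure ℝ)))] with ξ h
      rw [h, Pi.add_apply, add_mul]
    · exact (Lp.memLp _).integrable_mul (memLp_kernelHat k u hv)
    · exact (Lp.memLp _).integrable_mul (memLp_kernelHat k u hv)
  map_smul' := by
    intro c f
    rw [RingHom.id_apply, ← MemLp.toLp_const_smul]
    refine MemLp.toLp_congr _ _ ?_
    filter_upwards [ae_haarG_pos] with ⟨u, v⟩ hv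
    have e : (𝓕 ((c • f : hardySpace) : Lp ℂ 2 (volume : Measure ℝ)) : Lp ℂ 2 (volume : Measure ℝ))
      = c • 𝓕 (f : Lp ℂ 2 (volume : Measure ℝ)) :=
      (Lp.fourierTransformₗᵢ ℝ ℂ).map_smul _ _
    rw [Pi.smul_apply, waveletTransform_eq k _ u hv, waveletTransform_eq k _ u hv, e,
      ← integral_smul]
    refine integral_congr_ae ?_
    filter_upwards [Lp.coeFn_smul c (𝓕 (f : Lp ℂ 2 (volume : Measure ℝ)) :
      Lp ℂ 2 (volume : Measure ℝ))] with ξ h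
    rw [h, Pi.smul_apply, smul_mul_assoc]

/-- The wavelet subspace `A^{(k)} = {W_k f : f ∈ H_2^+(ℝ)}` of `L_2(G, dν)`. -/
noncomputable def waveletSpace (k : ℕ) : Submodule ℂ (Lp ℂ 2 haarG) :=
  LinearMap.range (waveletMap k)

theorem norm_waveletMap (k : ℕ) (f : hardySpace) :
    ‖waveletMap k f‖ = (laguerreMass k ^ (1 / 2 : ℝ)).toReal * ‖f‖ := by
  change ‖(memLp_waveletTransform k f).toLp _‖ = _
  rw [Lp.norm_toLp, eLpNorm_waveletTransform, ENNReal.toReal_mul, toReal_enorm]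

theorem isClosed_hardySpace : IsClosed (hardySpace : Set (Lp ℂ 2 (volume : Measure ℝ))) := by
  have e : (hardySpace : Set (Lp ℂ 2 (volume : Measure ℝ))) =
      (fun h => LpToLpRestrictCLM ℝ ℂ ℂ volume 2 (Iio 0)
        (𝓕 h : Lp ℂ 2 (volume : Measure ℝ))) ⁻¹' {0} := by
    ext h
    rw [mem_preimage, mem_singleton_iff, Lp.eq_zero_iff_ae_eq_zero]
    have h1 := LpToLpRestrictCLM_coeFn (𝕜 := ℂ) (Iio 0) (𝓕 h : Lp ℂ 2 (volume : Measure ℝ))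
    change (∀ᵐ ξ ∂(volume : Measure ℝ), ξ < 0 → _) ↔ _
    have h3 := ae_restrict_iff' (μ := (volume : Measure ℝ)) (s := Iio (0 : ℝ))
      (p := fun ξ => (𝓕 h : Lp ℂ 2 (volume : Measure ℝ)) ξ = 0) measurableSet_Iio
    refine Iff.trans h3.symm ?_
    constructor
    · intro h2
      filter_upwards [h1, h2] with ξ a b
      rw [a, b, Pi.zero_apply]
    · intro h2
      filter_upwards [h1, h2] with ξ a b
      rw [← a, b, Pi.zero_apply]
  rw [e]
  exact isClosed_singleton.preimage ((ContinuousLinearMap.continuous _).comp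
    (Lp.fourierTransformₗᵢ ℝ ℂ).continuous)

instance completeSpace_waveletSpace (k : ℕ) : CompleteSpace (waveletSpace k) := by
  have hc : 0 < (laguerreMass k ^ (1 / 2 : ℝ)).toReal := by
    refine ENNReal.toReal_pos ?_ (ENNReal.rpow_ne_top_of_nonneg (by norm_num)
      (laguerreMass_ne_top k))
    simp [ENNReal.rpow_eq_zero_iff, laguerreMass_ne_zero]
  have : CompleteSpace hardySpace := isClosed_hardySpace.completeSpace_coe
  set c := (laguerreMass k ^ (1 / 2 : ℝ)).toReal with hcd
  have hL : LipschitzWith ⟨c, hc.le⟩ (waveletMap k) :=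
    AddMonoidHomClass.lipschitz_of_bound_nnnorm (waveletMap k) ⟨c, hc.le⟩ fun f =>
      (norm_waveletMap k f).le
  have hA : AntilipschitzWith ⟨c⁻¹, (inv_pos.2 hc).le⟩ (waveletMap k) :=
    AddMonoidHomClass.antilipschitz_of_bound (waveletMap k) fun f => by
      rw [norm_waveletMap]
      change _ ≤ c⁻¹ * _
      rw [inv_mul_cancel_left₀ hc.ne']
  exact (hA.isComplete_range hL.uniformContinuous).completeSpace_coe

/-- The operator `M_a` of multiplication by `a ∈ L_∞(G)` on `L_2(G, dν)`. -/
noncomputable def mulOp (a : Lp ℂ ⊤ haarG) : Lp ℂ 2 haarG →L[ℂ] Lp ℂ 2 haarG :=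
  (ContinuousLinearMap.mul ℂ ℂ).holderL haarG ⊤ 2 2 a

/-- The Hilbert space `A^{(k)}` (the subspace `waveletSpace k` as a type of its own). -/
def WaveletHilbert (k : ℕ) : Type := waveletSpace k

noncomputable instance (k : ℕ) : NormedAddCommGroup (WaveletHilbert k) :=
  inferInstanceAs (NormedAddCommGroup (waveletSpace k))

noncomputable instance (k : ℕ) : InnerProductSpace ℂ (WaveletHilbert k) :=
  inferInstanceAs (InnerProductSpace ℂ (waveletSpace k))

instance (k : ℕ) : CompleteSpace (WaveletHilbert k) :=
  inferInstanceAs (CompleteSpace (waveletSpace k))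

/-- The inclusion `A^{(k)} ⊆ L_2(G, dν)`. -/
noncomputable def waveletIncl (k : ℕ) : WaveletHilbert k →L[ℂ] Lp ℂ 2 haarG :=
  (waveletSpace k).subtypeL

/-- The orthogonal projection `P^{(k)}` of `L_2(G, dν)` onto `A^{(k)}`. -/
noncomputable def waveletProj (k : ℕ) : Lp ℂ 2 haarG →L[ℂ] WaveletHilbert k :=
  (waveletSpace k).orthogonalProjectionOnto

/-- The Calderón–Toeplitz operator `T_a^{(k)} = P^{(k)} M_a` on `A^{(k)}` with bounded symbol
`a` on `G`. -/
noncomputable def toeplitzOp (k : ℕ) (a : Lp ℂ ⊤ haarG) : WaveletHilbert k →L[ℂ] WaveletHilbert k :=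
  waveletProj k ∘L mulOp a ∘L waveletIncl k

theorem memLp_comp_snd (a : Lp ℂ ⊤ halfLine) : MemLp (fun p : ℝ × ℝ => a p.2) ⊤ haarG := by
  have q : Measure.QuasiMeasurePreserving (Prod.snd : ℝ × ℝ → ℝ) haarG halfLine :=
    Measure.quasiMeasurePreserving_snd.mono_right (withDensity_absolutelyContinuous _ _)
  refine memLp_top_of_bound ((Lp.aestronglyMeasurable a).comp_quasiMeasurePreserving q) ‖a‖ ?_
  refine q.ae (p := fun v => ‖a v‖ ≤ ‖a‖) ?_
  filter_upwards [enorm_ae_le_eLpNormEssSup a halfLine] with v hv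
  rw [Lp.norm_def, eLpNorm_exponent_top, ← toReal_enorm]
  exact ENNReal.toReal_mono (by simpa using (Lp.eLpNorm_ne_top a)) hv

/-- A symbol `a ∈ L_∞(ℝ_+)` regarded as the symbol `(u, v) ↦ a(v)` on `G`. -/
noncomputable def verticalSymbol (a : Lp ℂ ⊤ halfLine) : Lp ℂ ⊤ haarG :=
  (memLp_comp_snd a).toLp _

/-- The operator `T_a^{(k)}` for a symbol `a = a(v)` in `L_∞(ℝ_+)`. -/
noncomputable def verticalToeplitz (k : ℕ) (a : Lp ℂ ⊤ halfLine) :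
    WaveletHilbert k →L[ℂ] WaveletHilbert k :=
  toeplitzOp k (verticalSymbol a)

/-- The `C*`-algebra `𝒯_k(𝒜)`: the smallest norm-closed `*`-subalgebra of the bounded operators
on `A^{(k)}` containing all `T_a^{(k)}`, `a ∈ 𝒜`. -/
noncomputable def toeplitzAlgebra (k : ℕ) (𝒜 : Submodule ℂ (Lp ℂ ⊤ halfLine)) :
    NonUnitalStarSubalgebra ℂ (WaveletHilbert k →L[ℂ] WaveletHilbert k) :=
  (NonUnitalStarAlgebra.adjoin ℂ (verticalToeplitz k '' 𝒜)).topologicalClosure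

theorem verticalToeplitz_mem (k : ℕ) {𝒜 : Submodule ℂ (Lp ℂ ⊤ halfLine)} {a : Lp ℂ ⊤ halfLine}
    (ha : a ∈ 𝒜) : verticalToeplitz k a ∈ toeplitzAlgebra k 𝒜 :=
  NonUnitalStarSubalgebra.le_topologicalClosure _
    (NonUnitalStarAlgebra.subset_adjoin ℂ _ (mem_image_of_mem _ ha))

/-- The set `L_∞^{{0,+∞}}(ℝ_+)` of classes in `L_∞(ℝ_+)` having limits at `0` and at `+∞`, i.e.
with a representative that has both limits. -/
def endpointLimits : Set (Lp ℂ ⊤ halfLine) :=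
  {a | ∃ g : ℝ → ℂ, a =ᵐ[halfLine] g ∧ (∃ a₀, Tendsto g (𝓝[>] 0) (𝓝 a₀)) ∧
    ∃ a_inf, Tendsto g atTop (𝓝 a_inf)}

/-- The constant symbol `1`. -/
noncomputable def oneSymbol : Lp ℂ ⊤ halfLine := (memLp_top_const (1 : ℂ)).toLp _

/-- `L(1, a₁)`: the linear span of `1` and `a₁`. -/
noncomputable def spanOne (a₁ : Lp ℂ ⊤ halfLine) : Submodule ℂ (Lp ℂ ⊤ halfLine) :=
  Submodule.span ℂ {oneSymbol, a₁}

/-- `γ_{a,k}(ξ) = ∫_{ℝ_+} a(v / (2ξ)) ℓ_k(v)^2 dv`, for `ξ > 0`. -/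
noncomputable def gammaFun (k : ℕ) (a : ℝ → ℂ) (ξ : ℝ) : ℂ :=
  ∫ v in Ioi (0 : ℝ), a (v / (2 * ξ)) * ((laguerreFun k v ^ 2 : ℝ) : ℂ)

open Classical in
/-- `γ_{a,k}` as a function on `[0, +∞]`: the values at the endpoints are the limits of
`γ_{a,k}(ξ)` as `ξ → 0` and as `ξ → +∞`. -/
noncomputable def gammaExt (k : ℕ) (a : ℝ → ℂ) (ξ : ℝ≥0∞) : ℂ :=
  if ξ = 0 then limUnder (𝓝[>] (0 : ℝ)) (gammaFun k a)
  else if ξ = ⊤ then limUnder atTop (gammaFun k a)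
  else gammaFun k a ξ.toReal

end CalderonToeplitz

open CalderonToeplitz

/-! The Toeplitz operators with symbols `a(v)` are simultaneously diagonalizable. Such a symbol is
invariant under translation in `u`, so on the Fourier side in `u` the form `⟨F, aF⟩` with `F = W_k
f` becomes an integral of `|f̂(ξ)|²` against a weight in `ξ`. Integrating out `v` shows that this
weight is `γ_{a,k}(ξ)` (`integral_kernelHat`, `inner_verticalToeplitz`). Since `∫ ℓ_k² = 1`
(`integral_laguerre_sq`), the wavelet transform is unitary from `H_2^+` onto `A^{(k)}`, so `T_a` is
unitarily equivalent to multiplication by `γ_{a,k}` on `L²(0, ∞)` (`verticalToeplitz_eq`).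

When `a` has limits at `0` and `+∞`, `γ_{a,k}` is continuous on `[0, +∞]` (`continuous_gammaExt`).
Multiplication by functions in `C[0, +∞]` is a faithful, hence isometric, representation `contRep`
on `A^{(k)}`. The Toeplitz algebra lies in its closed range. Conversely, the functions represented
inside the Toeplitz algebra form a closed `*`-subalgebra that contains `1` and separates points, so
Stone–Weierstrass gives all of `C[0, +∞]`. The isomorphism `τ_k` is the inverse of this
representation. -/

namespace CalderonToeplitz

/-! ### Normalization of the Laguerre functions -/

/-- The sum is the `k`-th forward difference of the degree-`i` polynomial `x ↦ C(x, i)`, taken at `x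
= i`. After `i` differences this polynomial is the constant `1`, which any further difference kills.
-/
theorem sum_alternating_choose_mul_choose_add (k i : ℕ) (hi : i ≤ k) :
    ∑ j ∈ Finset.range (k + 1), ((-1 : ℤ) ^ (k - j) * (k.choose j : ℤ)) * ((i + j).choose i : ℤ) =
      if i = k then 1 else 0 := by
  have h := fwdDiff_iter_eq_sum_shift (1 : ℕ) (fun x : ℕ => (x.choose i : ℤ)) k i
  simp only [smul_eq_mul, mul_one] at h
  rw [← h]
  obtain ⟨d, rfl⟩ := Nat.exists_eq_add_of_le hi
  have hd := fwdDiff_iter_choose 0 i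
  simp only [add_zero, Nat.choose_zero_right, Nat.cast_one] at hd
  rw [add_comm i d, Function.iterate_add_apply, hd]
  rcases d with _ | d
  · simp
  · rw [if_neg (by omega), Function.iterate_succ_apply, fwdDiff_const,
      fwdDiff_iter_eq_sum_shift]
    simp

/-- This is `∫ e^{-t} L_k(t)² dt` expanded with `∫ e^{-t} t^{i+j} dt = (i+j)!`. As `(i+j)!/(i! j!) =
C(i+j, i)`, each row is a multiple of the preceding alternating sum, and only the row `i = k`
survives. -/
theorem sum_laguerre_coeff (k : ℕ) :
    ∑ i ∈ Finset.range (k + 1), ∑ j ∈ Finset.range (k + 1),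
      ((-1 : ℝ) ^ i * (k.choose i : ℝ) / (i.factorial : ℝ)) *
        ((-1 : ℝ) ^ j * (k.choose j : ℝ) / (j.factorial : ℝ)) * ((i + j).factorial : ℝ) = 1 := by
  have inner : ∀ i ∈ Finset.range (k + 1), ∑ j ∈ Finset.range (k + 1),
      ((-1 : ℝ) ^ i * (k.choose i : ℝ) / (i.factorial : ℝ)) *
        ((-1 : ℝ) ^ j * (k.choose j : ℝ) / (j.factorial : ℝ)) * ((i + j).factorial : ℝ) =
      if i = k then 1 else 0 := by
    intro i hi
    have hi' : i ≤ k := Nat.lt_succ_iff.1 (Finset.mem_range.1 hi)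
    -- The factor `(-1)^k` turns the sign `(-1)^(k-j)` of the finite difference into `(-1)^j`.
    have h := congrArg (fun z : ℤ => (-1 : ℝ) ^ i * (k.choose i : ℝ) * (-1) ^ k * (z : ℝ))
      (sum_alternating_choose_mul_choose_add k i hi')
    simp only [Int.cast_sum, Finset.mul_sum] at h
    refine Eq.trans (Finset.sum_congr rfl fun j hj => ?_) (h.trans ?_)
    · have hj' : j ≤ k := Nat.lt_succ_iff.1 (Finset.mem_range.1 hj)
      have hc : ((i + j).factorial : ℝ) =
          ((i + j).choose i : ℝ) * (i.factorial : ℝ) * (j.factorial : ℝ) := by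
        have := Nat.add_choose_mul_factorial_mul_factorial i j
        rw [← Nat.choose_symm_add]  at this
        exact_mod_cast this.symm
      have hs : (-1 : ℝ) ^ k * (-1) ^ (k - j) = (-1) ^ j := by
        obtain ⟨d, rfl⟩ := Nat.exists_eq_add_of_le hj'
        rw [Nat.add_sub_cancel_left, pow_add, mul_assoc, ← pow_add, Even.neg_one_pow ⟨d, rfl⟩,
          mul_one]
      have h1 : (i.factorial : ℝ) ≠ 0 := by positivity
      have h2 : (j.factorial : ℝ) ≠ 0 := by positivity
      rw [hc, ← hs]
      push_cast
      field_simp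
    · split_ifs with e
      · subst e
        rw [Nat.choose_self, Nat.cast_one, mul_one, ← pow_add, Even.neg_one_pow ⟨i, rfl⟩]
        simp
      · simp
  rw [Finset.sum_congr rfl inner, Finset.sum_ite_eq', if_pos (by simp)]

theorem integral_laguerre_sq (k : ℕ) : ∫ t in Ioi (0 : ℝ), laguerreFun k t ^ 2 = 1 := by
  have hint : ∀ n : ℕ, IntegrableOn (fun t : ℝ => Real.exp (-t) * t ^ n) (Ioi 0) := by
    intro n
    have := Real.GammaIntegral_convergent (s := n + 1) (by positivity)
    simpa using this
  have hval : ∀ n : ℕ, ∫ t in Ioi (0 : ℝ), Real.exp (-t) * t ^ n = n.factorial := by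
    intro n
    have := Real.Gamma_eq_integral (s := n + 1) (by positivity)
    rw [Real.Gamma_nat_eq_factorial] at this
    rw [this]
    simp
  have hexp : ∀ t : ℝ, laguerreFun k t ^ 2 =
      ∑ i ∈ Finset.range (k + 1), ∑ j ∈ Finset.range (k + 1),
      ((-1 : ℝ) ^ i * (k.choose i : ℝ) / (i.factorial : ℝ)) *
        ((-1 : ℝ) ^ j * (k.choose j : ℝ) / (j.factorial : ℝ)) * (Real.exp (-t) * t ^ (i + j)) := by
    intro t
    have he : Real.exp (-t) = Real.exp (-t / 2) * Real.exp (-t / 2) := by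
      rw [← Real.exp_add]; ring_nf
    rw [laguerreFun, mul_pow, sq, ← he, sq, laguerrePoly, Finset.sum_mul_sum, Finset.mul_sum]
    refine Finset.sum_congr rfl fun i _ => ?_
    rw [Finset.mul_sum]
    refine Finset.sum_congr rfl fun j _ => ?_
    rw [pow_add]
    ring
  simp_rw [hexp]
  rw [integral_finsetSum _ fun i _ => integrable_finsetSum _ fun j _ => (hint _).const_mul _]
  refine Eq.trans (Finset.sum_congr rfl fun i _ => ?_) (sum_laguerre_coeff k)
  rw [integral_finsetSum _ fun j _ => (hint _).const_mul _]
  refine Finset.sum_congr rfl fun j _ => ?_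
  rw [integral_const_mul, hval]

theorem laguerreMass_eq_one (k : ℕ) : laguerreMass k = 1 := by
  rw [laguerreMass, ← ofReal_integral_eq_lintegral_ofReal (integrable_laguerre_sq k)
    (.of_forall fun t => sq_nonneg _), integral_laguerre_sq, ENNReal.ofReal_one]

/-! ### The function `γ` -/

theorem norm_le_norm_ae {α : Type*} [MeasurableSpace α] {μ : Measure α} (a : Lp ℂ ⊤ μ) :
    ∀ᵐ v ∂μ, ‖a v‖ ≤ ‖a‖ := by
  filter_upwards [enorm_ae_le_eLpNormEssSup a μ] with v hv
  rw [Lp.norm_def, eLpNorm_exponent_top, ← toReal_enorm]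
  exact ENNReal.toReal_mono (by simpa using (Lp.eLpNorm_ne_top a)) hv

/-- Dilations preserve null sets, so `a(v/(2ξ))` is well defined a.e. for a class `a`, and `γ_{a,k}`
can be computed with any representative. -/
theorem quasiMeasurePreserving_div_halfLine {c : ℝ} (hc : 0 < c) :
    Measure.QuasiMeasurePreserving (fun v : ℝ => v / c) halfLine halfLine := by
  refine ⟨by fun_prop, ?_⟩
  refine Measure.AbsolutelyContinuous.mk fun s hs h0 => ?_
  rw [Measure.map_apply (by fun_prop) hs]
  rw [halfLine, Measure.restrict_apply hs] at h0
  rw [halfLine, Measure.restrict_apply (hs.preimage (by fun_prop))]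
  have e : (fun v : ℝ => v / c) ⁻¹' s ∩ Ioi 0 = (fun v : ℝ => v / c) ⁻¹' (s ∩ Ioi 0) := by
    ext v
    simp [hc, div_pos_iff_of_pos_right]
  rw [e]
  simp only [div_eq_mul_inv]
  rw [Real.volume_preimage_mul_right (inv_pos.2 hc).ne', h0, mul_zero]

theorem gammaFun_congr (k : ℕ) {a g : ℝ → ℂ} (h : a =ᵐ[halfLine] g) {ξ : ℝ} (hξ : 0 < ξ) :
    gammaFun k a ξ = gammaFun k g ξ := by
  refine integral_congr_ae ?_
  filter_upwards [(quasiMeasurePreserving_div_halfLine (c := 2 * ξ) (by positivity)).ae h] with v hv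
  rw [hv]

/-- Dominated convergence with majorant `‖a‖ ℓ_k²`; the limit is exactly `L` because `ℓ_k²` has
total mass one. The pointwise limit is required of a representative `g`, since a class has no
pointwise values. -/
theorem tendsto_gammaFun_aux (k : ℕ) {a : Lp ℂ ⊤ halfLine} {g : ℝ → ℂ} (hg : a =ᵐ[halfLine] g)
    {l : Filter ℝ} [l.IsCountablyGenerated] (hl : ∀ᶠ ξ in l, 0 < ξ) {L : ℂ}
    (hL : ∀ v, 0 < v → Tendsto (fun ξ => g (v / (2 * ξ))) l (𝓝 L)) :
    Tendsto (gammaFun k a) l (𝓝 L) := by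
  have hone : ∫ v in Ioi (0 : ℝ), L * ((laguerreFun k v ^ 2 : ℝ) : ℂ) = L := by
    rw [integral_const_mul, integral_complex_ofReal, integral_laguerre_sq]; simp
  have hlag := ((continuous_laguerreFun k).pow 2)
  have key : Tendsto (gammaFun k g) l (𝓝 L) := by
    rw [← congrArg 𝓝 hone]
    refine tendsto_integral_filter_of_dominated_convergence
      (fun v => ‖a‖ * laguerreFun k v ^ 2) ?_ ?_ ((integrable_laguerre_sq k).const_mul _) ?_
    · filter_upwards [hl] with ξ hξ
      refine AEStronglyMeasurable.mul ?_
        (Complex.continuous_ofReal.comp hlag).aestronglyMeasurable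
      exact ((Lp.aestronglyMeasurable a).congr hg).comp_quasiMeasurePreserving
        (quasiMeasurePreserving_div_halfLine (c := 2 * ξ) (by positivity))
    · filter_upwards [hl] with ξ hξ
      filter_upwards [(quasiMeasurePreserving_div_halfLine (c := 2 * ξ) (by positivity)).ae
        ((norm_le_norm_ae a).and hg)] with v hv
      rw [norm_mul, Complex.norm_real, Real.norm_of_nonneg (sq_nonneg _), ← hv.2]
      exact mul_le_mul_of_nonneg_right hv.1 (sq_nonneg _)
    · filter_upwards [ae_restrict_mem measurableSet_Ioi] with v hv
      exact (hL v hv).mul_const _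
  refine key.congr' ?_
  filter_upwards [hl] with ξ hξ
  exact (gammaFun_congr k hg hξ).symm

/-- The endpoints are exchanged: as `ξ → 0` the argument `v/(2ξ)` tends to `+∞`, so the limit of `γ`
at `0` is that of `a` at `+∞`. -/
theorem exists_tendsto_gammaFun_zero (k : ℕ) {a : Lp ℂ ⊤ halfLine} (ha : a ∈ endpointLimits) :
    ∃ L, Tendsto (gammaFun k a) (𝓝[>] 0) (𝓝 L) := by
  obtain ⟨g, hg, -, L, hL⟩ := ha
  refine ⟨L, tendsto_gammaFun_aux k hg self_mem_nhdsWithin fun v hv => hL.comp ?_⟩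
  have h2 : Tendsto (fun ξ : ℝ => (2 * ξ)⁻¹) (𝓝[>] 0) atTop := by
    refine tendsto_inv_nhdsGT_zero.comp (tendsto_nhdsWithin_iff.2 ⟨?_, ?_⟩)
    · have : Tendsto (fun ξ : ℝ => 2 * ξ) (𝓝 0) (𝓝 (2 * 0)) :=
        Continuous.tendsto (by fun_prop) 0
      rw [mul_zero] at this
      exact this.mono_left nhdsWithin_le_nhds
    · filter_upwards [self_mem_nhdsWithin] with ξ hξ
      have : 0 < ξ := hξ
      show 0 < 2 * ξ
      positivity
  simp only [div_eq_mul_inv]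
  exact h2.const_mul_atTop hv

theorem exists_tendsto_gammaFun_atTop (k : ℕ) {a : Lp ℂ ⊤ halfLine} (ha : a ∈ endpointLimits) :
    ∃ L, Tendsto (gammaFun k a) atTop (𝓝 L) := by
  obtain ⟨g, hg, ⟨L, hL⟩, -⟩ := ha
  refine ⟨L, tendsto_gammaFun_aux k hg (eventually_gt_atTop 0) fun v hv =>
    hL.comp (tendsto_nhdsWithin_iff.2 ⟨?_, ?_⟩)⟩
  · exact tendsto_const_nhds.div_atTop (tendsto_id.const_mul_atTop two_pos)
  · filter_upwards [eventually_gt_atTop 0] with ξ hξ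
    show 0 < v / (2 * ξ)
    positivity

/-- Substitution moves the parameter `ξ` from the merely measurable `a` to the continuous `ℓ_k`,
which makes continuity in `ξ` accessible to dominated convergence. -/
theorem gammaFun_eq_integral (k : ℕ) (a : ℝ → ℂ) {ξ : ℝ} (hξ : 0 < ξ) :
    gammaFun k a ξ =
      ∫ v in Ioi (0 : ℝ), a v * ((2 * ξ * laguerreFun k (2 * ξ * v) ^ 2 : ℝ) : ℂ) := by
  have h := integral_comp_mul_left_Ioi
    (fun t => a (t / (2 * ξ)) * ((laguerreFun k t ^ 2 : ℝ) : ℂ)) 0 (by positivity : 0 < 2 * ξ)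
  rw [mul_zero] at h
  have h2 : gammaFun k a ξ = ((2 * ξ : ℝ) : ℂ) * ∫ v in Ioi (0 : ℝ),
      a (2 * ξ * v / (2 * ξ)) * ((laguerreFun k (2 * ξ * v) ^ 2 : ℝ) : ℂ) := by
    rw [h, Complex.real_smul, ← mul_assoc, ← Complex.ofReal_mul,
      mul_inv_cancel₀ (by positivity), Complex.ofReal_one, one_mul, gammaFun]
  rw [h2, ← integral_const_mul]
  refine integral_congr_ae (.of_forall fun v => ?_)
  simp only
  rw [mul_div_cancel_left₀ _ (by positivity)]
  push_cast
  ring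

theorem continuousAt_gammaFun (k : ℕ) (a : Lp ℂ ⊤ halfLine) {ξ₀ : ℝ} (h0 : 0 < ξ₀) :
    ContinuousAt (gammaFun k a) ξ₀ := by
  have hnear : ∀ᶠ ξ in 𝓝 ξ₀, ξ₀ / 2 < ξ ∧ ξ < 2 * ξ₀ :=
    Ioo_mem_nhds (by linarith) (by linarith)
  have hpos : ∀ᶠ ξ in 𝓝 ξ₀, 0 < ξ := eventually_gt_nhds h0
  obtain ⟨C, hC, hb⟩ := laguerreFun_bound k
  have hlag := continuous_laguerreFun k
  have key : ContinuousAt (fun ξ => ∫ v in Ioi (0 : ℝ),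
      a v * ((2 * ξ * laguerreFun k (2 * ξ * v) ^ 2 : ℝ) : ℂ)) ξ₀ := by
    -- For `ξ₀/2 < ξ < 2ξ₀` the prefactor `2ξ` is below `2(2ξ₀)`, and `2ξv > ξ₀v` in
    -- `laguerreFun_bound` gives `ℓ_k(2ξv)² ≤ C² exp(-(3/4) ξ₀ v)`.
    refine continuousAt_of_dominated (bound := fun v => ‖a‖ * (2 * (2 * ξ₀) * C ^ 2) *
      Real.exp (-(3 / 4 * ξ₀) * v)) ?_ ?_ ?_ ?_
    · exact .of_forall fun ξ => (Lp.aestronglyMeasurable a).mul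
        (Continuous.aestronglyMeasurable (by fun_prop))
    · filter_upwards [hnear, hpos] with ξ hξ hξ0
      filter_upwards [norm_le_norm_ae a, ae_restrict_mem measurableSet_Ioi] with v hv hv0
      have hv0' : 0 < v := hv0
      have e : Real.exp (-(3 / 4 * ξ₀) * v) = Real.exp (-3 / 8 * (ξ₀ * v)) ^ 2 := by
        rw [sq, ← Real.exp_add]; ring_nf
      rw [norm_mul, Complex.norm_real, Real.norm_of_nonneg (by positivity), e]
      have h1 : laguerreFun k (2 * ξ * v) ^ 2 ≤ C ^ 2 * Real.exp (-3 / 8 * (ξ₀ * v)) ^ 2 := by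
        rw [← mul_pow, ← sq_abs]
        gcongr
        refine (hb _ (by positivity)).trans ?_
        gcongr C * Real.exp ?_
        nlinarith [mul_lt_mul_of_pos_right hξ.1 hv0']
      calc _ ≤ ‖a‖ * (2 * (2 * ξ₀) * (C ^ 2 * Real.exp (-3 / 8 * (ξ₀ * v)) ^ 2)) := by
            refine mul_le_mul hv (mul_le_mul ?_ h1 ?_ ?_) ?_ ?_
            · linarith [hξ.2]
            all_goals positivity
        _ = _ := by ring
    · exact (exp_neg_integrableOn_Ioi 0 (by positivity : 0 < 3 / 4 * ξ₀)).const_mul _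
    · exact .of_forall fun v => Continuous.continuousAt (by fun_prop)
  refine key.congr ?_
  filter_upwards [hpos] with ξ hξ
  exact (gammaFun_eq_integral k a hξ).symm

/-- At `0` and `⊤` the value is a `limUnder`, which is the genuine limit because the limit exists;
in between, `toReal` reduces the claim to continuity on `(0, ∞)`. -/
theorem continuous_gammaExt (k : ℕ) {a : Lp ℂ ⊤ halfLine} (ha : a ∈ endpointLimits) :
    Continuous (gammaExt k a) := by
  have hfin : ∀ ξ : ℝ≥0∞, ξ ≠ 0 → ξ ≠ ⊤ → gammaExt k a ξ = gammaFun k a ξ.toReal :=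
    fun ξ h0 ht => by rw [gammaExt, if_neg h0, if_neg ht]
  rw [continuous_iff_continuousAt]
  intro ξ
  by_cases h0 : ξ = 0
  · subst h0
    obtain ⟨L, hL⟩ := exists_tendsto_gammaFun_zero k ha
    have hne : ∀ᶠ ξ : ℝ≥0∞ in 𝓝[≠] 0, ξ ≠ 0 ∧ ξ ≠ ⊤ :=
      Eventually.and self_mem_nhdsWithin (nhdsWithin_le_nhds (isOpen_ne.mem_nhds (by simp)))
    rw [continuousAt_iff_punctured_nhds, gammaExt, if_pos rfl, hL.limUnder_eq]
    have ht : Tendsto ENNReal.toReal (𝓝[≠] 0) (𝓝[>] 0) := by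
      refine tendsto_nhdsWithin_iff.2 ⟨?_, ?_⟩
      · exact (ENNReal.tendsto_toReal ENNReal.zero_ne_top).mono_left nhdsWithin_le_nhds
      · filter_upwards [hne] with ξ hξ
        exact ENNReal.toReal_pos hξ.1 hξ.2
    refine (hL.comp ht).congr' ?_
    filter_upwards [hne] with ξ hξ
    exact (hfin ξ hξ.1 hξ.2).symm
  by_cases ht : ξ = ⊤
  · subst ht
    obtain ⟨L, hL⟩ := exists_tendsto_gammaFun_atTop k ha
    have hne : ∀ᶠ ξ : ℝ≥0∞ in 𝓝[≠] ⊤, ξ ≠ ⊤ ∧ ξ ≠ 0 :=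
      Eventually.and self_mem_nhdsWithin (nhdsWithin_le_nhds (isOpen_ne.mem_nhds (by simp)))
    rw [continuousAt_iff_punctured_nhds, gammaExt, if_neg h0, if_pos rfl, hL.limUnder_eq]
    have ht : Tendsto ENNReal.toReal (𝓝[≠] ⊤) atTop := by
      refine tendsto_atTop.2 fun b => ?_
      filter_upwards [hne, nhdsWithin_le_nhds (lt_mem_nhds (ENNReal.ofReal_lt_top (r := b)))]
        with ξ hξ hb
      exact (ENNReal.ofReal_le_iff_le_toReal hξ.1).1 hb.le
    refine (hL.comp ht).congr' ?_
    filter_upwards [hne] with ξ hξ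
    exact (hfin ξ hξ.2 hξ.1).symm
  · have h1 : ContinuousAt (fun η : ℝ≥0∞ => gammaFun k a η.toReal) ξ :=
      ContinuousAt.comp (f := ENNReal.toReal)
        (continuousAt_gammaFun k a (ENNReal.toReal_pos h0 ht)) (ENNReal.tendsto_toReal ht)
    refine h1.congr ?_
    filter_upwards [isOpen_ne.mem_nhds h0, isOpen_ne.mem_nhds ht] with η a b
    exact (hfin η a b).symm

theorem spanOne_subset_endpointLimits {a₁ : Lp ℂ ⊤ halfLine} (ha₁ : a₁ ∈ endpointLimits)
    {a : Lp ℂ ⊤ halfLine} (ha : a ∈ spanOne a₁) : a ∈ endpointLimits := by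
  obtain ⟨c, d, rfl⟩ := Submodule.mem_span_pair.1 ha
  obtain ⟨g, hg, ⟨x, hx⟩, y, hy⟩ := ha₁
  refine ⟨fun v => c + d * g v, ?_, ⟨_, (hx.const_mul d).const_add c⟩,
    _, (hy.const_mul d).const_add c⟩
  have h1 : (oneSymbol : ℝ → ℂ) =ᵐ[halfLine] fun _ => 1 := MemLp.coeFn_toLp _
  filter_upwards [hg, h1, Lp.coeFn_add (c • oneSymbol) (d • a₁), Lp.coeFn_smul c oneSymbol,
    Lp.coeFn_smul d a₁] with v e1 e2 e3 e4 e5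
  rw [e3, Pi.add_apply, e4, e5, Pi.smul_apply, Pi.smul_apply, e1, e2]
  simp

theorem gammaExt_oneSymbol (k : ℕ) (ξ : ℝ≥0∞) : gammaExt k oneSymbol ξ = 1 := by
  have h1 : (oneSymbol : ℝ → ℂ) =ᵐ[halfLine] fun _ => 1 := MemLp.coeFn_toLp _
  unfold gammaExt
  split_ifs with h0 ht
  · exact (tendsto_gammaFun_aux (l := 𝓝[>] 0) k h1 self_mem_nhdsWithin
      fun _ _ => tendsto_const_nhds).limUnder_eq
  · exact (tendsto_gammaFun_aux k h1 (eventually_gt_atTop 0)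
      fun _ _ => tendsto_const_nhds).limUnder_eq
  · rw [gammaFun_congr k h1 (ENNReal.toReal_pos h0 ht), gammaFun]
    simp only [one_mul]
    rw [integral_complex_ofReal, integral_laguerre_sq, Complex.ofReal_one]


/-! ### Multiplication operators on `L²(0, ∞)` -/

theorem memLp_symbol (h : C(ℝ≥0∞, ℂ)) :
    MemLp (fun x : ℝ => h (ENNReal.ofReal x)) ⊤ halfLine :=
  memLp_top_of_bound (h.continuous.comp ENNReal.continuous_ofReal).aestronglyMeasurable ‖h‖
    (.of_forall fun _ => h.norm_coe_le_norm _)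

/-- Multiplication by a continuous function on `[0, ∞]`, as an operator on `L²(0, ∞)`. -/
noncomputable def mulCont (h : C(ℝ≥0∞, ℂ)) : Lp ℂ 2 halfLine →L[ℂ] Lp ℂ 2 halfLine :=
  (ContinuousLinearMap.mul ℂ ℂ).holderL halfLine ⊤ 2 2 ((memLp_symbol h).toLp _)

theorem mulCont_coeFn (h : C(ℝ≥0∞, ℂ)) (φ : Lp ℂ 2 halfLine) :
    mulCont h φ =ᵐ[halfLine] fun x => h (ENNReal.ofReal x) * φ x := by
  have e := (ContinuousLinearMap.mul ℂ ℂ).coeFn_holder (r := 2) ((memLp_symbol h).toLp _) φ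
  filter_upwards [e, (memLp_symbol h).coeFn_toLp] with x h1 h2
  change (((ContinuousLinearMap.mul ℂ ℂ).holder 2 ((memLp_symbol h).toLp _) φ :
    Lp ℂ 2 halfLine) : ℝ → ℂ) x = _
  rw [h1, h2]
  rfl

theorem mulCont_star (h : C(ℝ≥0∞, ℂ)) : mulCont (star h) = star (mulCont h) := by
  rw [ContinuousLinearMap.star_eq_adjoint, ContinuousLinearMap.eq_adjoint_iff]
  intro φ χ
  rw [L2.inner_def, L2.inner_def]
  refine integral_congr_ae ?_
  filter_upwards [mulCont_coeFn (star h) φ, mulCont_coeFn h χ] with x h1 h2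
  rw [h1, h2]
  simp only [ContinuousMap.star_apply, RCLike.inner_apply, map_mul, RCLike.star_def,
    RCLike.conj_conj]
  ring

/-- The representation of `C[0, ∞]` by multiplication operators on `L²(0, ∞)`. -/
noncomputable def mulContHom :
    C(ℝ≥0∞, ℂ) →⋆ₙₐ[ℂ] (Lp ℂ 2 halfLine →L[ℂ] Lp ℂ 2 halfLine) where
  toFun := mulCont
  map_smul' c h := by
    refine ContinuousLinearMap.ext fun φ => Lp.ext ?_
    filter_upwards [mulCont_coeFn (c • h) φ, mulCont_coeFn h φ, Lp.coeFn_smul c (mulCont h φ)]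
      with x h1 h2 h3
    change _ = (c • mulCont h φ : Lp ℂ 2 halfLine) x
    rw [h1, h3, Pi.smul_apply, h2, ContinuousMap.smul_apply, smul_mul_assoc]
  map_zero' := by
    refine ContinuousLinearMap.ext fun φ => Lp.ext ?_
    filter_upwards [mulCont_coeFn 0 φ, Lp.coeFn_zero ℂ 2 halfLine] with x h1 h2
    change _ = (0 : Lp ℂ 2 halfLine) x
    rw [h1, h2, ContinuousMap.zero_apply, zero_mul, Pi.zero_apply]
  map_add' h g := by
    refine ContinuousLinearMap.ext fun φ => Lp.ext ?_
    filter_upwards [mulCont_coeFn (h + g) φ, mulCont_coeFn h φ, mulCont_coeFn g φ,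
      Lp.coeFn_add (mulCont h φ) (mulCont g φ)] with x h1 h2 h3 h4
    change _ = (mulCont h φ + mulCont g φ : Lp ℂ 2 halfLine) x
    rw [h1, h4, Pi.add_apply, h2, h3, ContinuousMap.add_apply, add_mul]
  map_mul' h g := by
    refine ContinuousLinearMap.ext fun φ => Lp.ext ?_
    filter_upwards [mulCont_coeFn (h * g) φ, mulCont_coeFn h (mulCont g φ), mulCont_coeFn g φ]
      with x h1 h2 h3
    change _ = mulCont h (mulCont g φ) x
    rw [h1, h2, h3, ContinuousMap.mul_apply, mul_assoc]
  map_star' := mulCont_star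

/-- The test vector `e^{-x/2}` vanishes nowhere, so a null operator forces `h = 0` a.e. on `(0, ∞)`.
Continuity makes this hold everywhere there, and density of `(0, ∞)` in `[0, ∞]` covers the
endpoints. -/
theorem mulContHom_injective : Function.Injective mulContHom := by
  refine (injective_iff_map_eq_zero mulContHom).2 fun h hh => ?_
  have hφ : MemLp (fun x : ℝ => ((Real.exp (-(1 / 2) * x) : ℝ) : ℂ)) 2 halfLine := by
    refine MemLp.ofReal (K := ℂ) (f := fun x : ℝ => Real.exp (-(1 / 2) * x)) ?_
    rw [memLp_two_iff_integrable_sq (Continuous.aestronglyMeasurable (by fun_prop))]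
    refine (exp_neg_integrableOn_Ioi 0 one_pos).congr (.of_forall fun x => ?_)
    simp only
    rw [sq, ← Real.exp_add]
    ring_nf
  have hz : mulCont h (hφ.toLp _) = 0 := by
    change mulContHom h (hφ.toLp _) = 0
    rw [hh]
    rfl
  have h1 : (fun x : ℝ => h (ENNReal.ofReal x)) =ᵐ[volume.restrict (Ioi 0)] fun _ => 0 := by
    have h2 := mulCont_coeFn h (hφ.toLp _)
    rw [hz] at h2
    filter_upwards [h2, hφ.coeFn_toLp, Lp.coeFn_zero ℂ 2 halfLine] with x a b c
    rw [b, c, Pi.zero_apply] at a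
    refine (mul_eq_zero.1 a.symm).resolve_right ?_
    exact_mod_cast (Real.exp_pos _).ne'
  have h3 : EqOn (fun x : ℝ => h (ENNReal.ofReal x)) (fun _ => 0) (Ioi 0) :=
    Measure.eqOn_open_of_ae_eq h1 isOpen_Ioi
      (h.continuous.comp ENNReal.continuous_ofReal).continuousOn continuousOn_const
  have h4 : EqOn h (fun _ => 0) (Ioo 0 ⊤) := by
    intro y hy
    have := h3 (show y.toReal ∈ Ioi (0 : ℝ) from ENNReal.toReal_pos hy.1.ne' hy.2.ne)
    simpa only [ENNReal.ofReal_toReal hy.2.ne] using this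
  have h5 := h4.closure h.continuous continuous_const
  rw [closure_Ioo (by simp)] at h5
  ext y
  exact h5 ⟨bot_le, le_top⟩

/-! ### The wavelet space as `L²(0, ∞)` -/

/-- Plancherel: the transform vanishes a.e. on the negative half-line, so restricting it loses no
norm. -/
theorem norm_restrict_fourier (f : hardySpace) :
    ‖LpToLpRestrictCLM ℝ ℂ ℂ volume 2 (Ioi 0)
      (𝓕 (f : Lp ℂ 2 (volume : Measure ℝ)) : Lp ℂ 2 (volume : Measure ℝ))‖ = ‖f‖ := by
  obtain ⟨f, hf⟩ := f
  change _ = ‖f‖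
  rw [← Lp.norm_fourier_eq f, Lp.norm_def, Lp.norm_def]
  congr 1
  rw [eLpNorm_congr_ae (LpToLpRestrictCLM_coeFn (𝕜 := ℂ) (Ioi 0) _),
    ← eLpNorm_indicator_eq_eLpNorm_restrict measurableSet_Ioi]
  refine eLpNorm_congr_ae ?_
  have h0 : ∀ᵐ ξ ∂(volume : Measure ℝ), ξ ≠ 0 := by simp [ae_iff]
  filter_upwards [hf, h0] with ξ h1 h2
  by_cases h : 0 < ξ
  · rw [indicator_of_mem (by exact h)]
  · rw [indicator_of_notMem (by exact h), h1 (lt_of_le_of_ne (not_lt.1 h) h2)]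

/-- The Fourier transform restricted to `(0, ∞)`, from `H_2^+(ℝ)` into `L²(0, ∞)`. -/
noncomputable def hardyFourier : hardySpace →ₗᵢ[ℂ] Lp ℂ 2 halfLine where
  toLinearMap := (LpToLpRestrictCLM ℝ ℂ ℂ volume 2 (Ioi 0)).toLinearMap ∘ₗ
    (Lp.fourierTransformₗᵢ ℝ ℂ).toLinearEquiv.toLinearMap ∘ₗ hardySpace.subtype
  norm_map' f := norm_restrict_fourier f

theorem hardyFourier_coeFn (f : hardySpace) :
    hardyFourier f =ᵐ[halfLine]
      (𝓕 (f : Lp ℂ 2 (volume : Measure ℝ)) : Lp ℂ 2 (volume : Measure ℝ)) :=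
  LpToLpRestrictCLM_coeFn (𝕜 := ℂ) (Ioi 0)
    (𝓕 (f : Lp ℂ 2 (volume : Measure ℝ)) : Lp ℂ 2 (volume : Measure ℝ))

/-- A preimage is obtained by extending by zero to the line and inverting the Fourier transform. -/
theorem hardyFourier_surjective : Function.Surjective hardyFourier := by
  intro φ
  have hφ : MemLp ((Ioi (0 : ℝ)).indicator φ) 2 volume :=
    (memLp_indicator_iff_restrict measurableSet_Ioi).2 (Lp.memLp φ)
  set g : Lp ℂ 2 (volume : Measure ℝ) := hφ.toLp _ with hg
  set f : Lp ℂ 2 (volume : Measure ℝ) := (Lp.fourierTransformₗᵢ ℝ ℂ).symm g with hf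
  have hfg : (𝓕 f : Lp ℂ 2 (volume : Measure ℝ)) = g :=
    (Lp.fourierTransformₗᵢ ℝ ℂ).apply_symm_apply g
  have hmem : f ∈ hardySpace := by
    change ∀ᵐ ξ ∂(volume : Measure ℝ), ξ < 0 → (𝓕 f : Lp ℂ 2 (volume : Measure ℝ)) ξ = 0
    rw [hfg]
    filter_upwards [hφ.coeFn_toLp] with ξ h1 h2
    rw [h1, indicator_of_notMem (by simpa using h2.le)]
  refine ⟨⟨f, hmem⟩, Lp.ext ?_⟩
  filter_upwards [hardyFourier_coeFn ⟨f, hmem⟩, ae_restrict_of_ae hφ.coeFn_toLp,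
    ae_restrict_mem measurableSet_Ioi] with ξ h1 h2 h3
  rw [h1]
  rw [hfg, h2, indicator_of_mem h3]

/-- The wavelet transform as an isometry of `H_2^+(ℝ)` onto `A^{(k)}`. -/
noncomputable def waveletIsometry (k : ℕ) : hardySpace →ₗᵢ[ℂ] WaveletHilbert k where
  toLinearMap := (waveletMap k).rangeRestrict
  norm_map' f := by
    refine (norm_waveletMap k f).trans ?_
    rw [laguerreMass_eq_one, ENNReal.one_rpow, ENNReal.toReal_one, one_mul]

theorem waveletIsometry_surjective (k : ℕ) : Function.Surjective (waveletIsometry k) :=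
  (waveletMap k).surjective_rangeRestrict

/-- The unitary `L²(0, ∞) → A^{(k)}` that diagonalizes the vertical Toeplitz operators. -/
noncomputable def waveletUnitary (k : ℕ) : Lp ℂ 2 halfLine ≃ₗᵢ[ℂ] WaveletHilbert k :=
  (LinearIsometryEquiv.ofSurjective hardyFourier hardyFourier_surjective).symm.trans
    (LinearIsometryEquiv.ofSurjective (waveletIsometry k) (waveletIsometry_surjective k))

theorem waveletUnitary_hardyFourier (k : ℕ) (f : hardySpace) :
    waveletUnitary k (hardyFourier f) = waveletIsometry k f := by
  change waveletIsometry k ((LinearIsometryEquiv.ofSurjective hardyFourier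
    hardyFourier_surjective).symm (hardyFourier f)) = _
  congr 1
  exact (LinearIsometryEquiv.ofSurjective hardyFourier
    hardyFourier_surjective).symm_apply_apply f

/-! ### The quadratic form of a vertical Toeplitz operator -/

/-- The measure `v⁻² dv` on `(0, ∞)`. -/
noncomputable abbrev dilationMeasure : Measure ℝ :=
  halfLine.withDensity fun v => ENNReal.ofReal (1 / v ^ 2)

/-- The source of `γ`: `|kernelHat k 0 v ξ|² = 2ξ v² ℓ_k(2ξv)²`, and the density `v⁻²` cancels the
factor `v²`. -/
theorem integral_kernelHat (k : ℕ) (a : ℝ → ℂ) {ξ : ℝ} (hξ : 0 < ξ) :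
    ∫ v, a v * ((‖kernelHat k 0 v ξ‖ ^ 2 : ℝ) : ℂ) ∂dilationMeasure = gammaFun k a ξ := by
  rw [integral_withDensity_eq_integral_toReal_smul (by fun_prop) (.of_forall fun _ => by simp),
    gammaFun_eq_integral k a hξ]
  refine setIntegral_congr_fun measurableSet_Ioi fun v (hv : 0 < v) => ?_
  rw [ENNReal.toReal_ofReal (by positivity), norm_kernelHat, waveletHat, if_pos (by positivity),
    Complex.norm_real, Complex.real_smul, mul_left_comm, ← Complex.ofReal_mul]
  congr 2
  rw [mul_pow, Real.norm_eq_abs, sq_abs, mul_pow, Real.sq_sqrt hv.le,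
    Real.sq_sqrt (by positivity), show 2 * ξ * v = 2 * (v * ξ) by ring]
  field_simp

theorem integral_waveletTransform_slice (k : ℕ) (f : Lp ℂ 2 (volume : Measure ℝ)) {v : ℝ}
    (hv : 0 < v) :
    ∫ u, ‖waveletTransform k f (u, v)‖ ^ 2 =
      ∫ ξ, ‖(𝓕 f : Lp ℂ 2 (volume : Measure ℝ)) ξ‖ ^ 2 * ‖kernelHat k 0 v ξ‖ ^ 2 := by
  have hm := (measurable_waveletTransform k f).measurable
  have hk := measurable_kernelHat k 0 v
  have hφ := (Lp.stronglyMeasurable (𝓕 f : Lp ℂ 2 (volume : Measure ℝ))).measurable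
  rw [integral_eq_lintegral_of_nonneg_ae (.of_forall fun _ => by positivity)
      (Measurable.aestronglyMeasurable (by fun_prop)),
    integral_eq_lintegral_of_nonneg_ae (.of_forall fun _ => by positivity)
      (Measurable.aestronglyMeasurable (by fun_prop))]
  have h := waveletTransform_slice k f hv
  have e : ∀ z : ℂ, ‖z‖ₑ ^ (2 : ℝ) = ENNReal.ofReal (‖z‖ ^ 2) := fun z => by
    rw [← ofReal_norm, ENNReal.ofReal_rpow_of_nonneg (norm_nonneg _) (by norm_num)]
    norm_num
  simp_rw [e, ← ENNReal.ofReal_mul (sq_nonneg _)] at h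
  rw [h]

/-- Tonelli, with `v` integrated first: `ξ > 0` contributes `|f̂(ξ)|²` times the Laguerre mass one,
and `ξ < 0` contributes nothing. This licenses Fubini below, where only a bounded factor `a` is
added. -/
theorem integrable_fourier_kernelHat (k : ℕ) (f : hardySpace) :
    Integrable (fun q : ℝ × ℝ => ‖(𝓕 (f : Lp ℂ 2 (volume : Measure ℝ)) :
      Lp ℂ 2 (volume : Measure ℝ)) q.2‖ ^ 2 * ‖kernelHat k 0 q.1 q.2‖ ^ 2)
      (dilationMeasure.prod volume) := by
  obtain ⟨f, hf⟩ := f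
  set φ : Lp ℂ 2 (volume : Measure ℝ) := 𝓕 f with hφ
  have hk := measurable_kernelHat_uncurry k
  have hφm := (Lp.stronglyMeasurable φ).measurable
  refine ⟨Measurable.aestronglyMeasurable (by fun_prop), ?_⟩
  have e : ∀ z : ℂ, ‖‖z‖ ^ 2‖ₑ = ‖z‖ₑ ^ (2 : ℝ) := fun z => by
    rw [enorm_pow, enorm_norm]
    norm_num
  have h2 : (∫⁻ ξ, ‖φ ξ‖ₑ ^ (2 : ℝ)) < ⊤ := by
    have b := eLpNorm_nnreal_pow_eq_lintegral (f := φ) (μ := (volume : Measure ℝ)) (p := 2)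
      (by norm_num)
    simp only [NNReal.coe_ofNat, ENNReal.coe_ofNat] at b
    rw [← b]
    exact ENNReal.rpow_lt_top_of_nonneg (by norm_num) (Lp.eLpNorm_ne_top φ)
  rw [hasFiniteIntegral_iff_enorm]
  simp only [enorm_mul, e]
  rw [lintegral_prod_symm _ (by fun_prop)]
  refine lt_of_le_of_lt (lintegral_mono_ae ?_) h2
  have h0 : ∀ᵐ ξ ∂(volume : Measure ℝ), ξ ≠ 0 := by simp [ae_iff]
  filter_upwards [hf, h0] with ξ h1 h2
  change ∫⁻ v, ‖φ ξ‖ₑ ^ (2 : ℝ) * ‖kernelHat k 0 v ξ‖ₑ ^ (2 : ℝ) ∂dilationMeasure ≤ _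
  rw [lintegral_const_mul _ (by fun_prop)]
  rcases lt_or_gt_of_ne h2 with h | h
  · rw [hφ, h1 h]; simp
  · rw [lintegral_kernelHat k h, laguerreMass_eq_one, mul_one]

/-- For fixed `v` the symbol is a constant in `u`, so Plancherel applies slice by slice; exchanging
the integrals then leaves `integral_kernelHat` in `v`. -/
theorem integral_waveletTransform_sq (k : ℕ) (a : Lp ℂ ⊤ halfLine) (f : hardySpace) :
    ∫ p, a p.2 * ((‖waveletTransform k (f : Lp ℂ 2 (volume : Measure ℝ)) p‖ ^ 2 : ℝ) : ℂ) ∂haarG =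
      ∫ ξ in Ioi (0 : ℝ), gammaFun k a ξ * ((‖(𝓕 (f : Lp ℂ 2 (volume : Measure ℝ)) :
        Lp ℂ 2 (volume : Measure ℝ)) ξ‖ ^ 2 : ℝ) : ℂ) := by
  set φ : Lp ℂ 2 (volume : Measure ℝ) := 𝓕 (f : Lp ℂ 2 (volume : Measure ℝ)) with hφ
  have hm : Measurable a := (Lp.stronglyMeasurable a).measurable
  have hbd : ∀ᵐ v ∂dilationMeasure, ‖a v‖ ≤ ‖a‖ :=
    (withDensity_absolutelyContinuous _ _).ae_le (norm_le_norm_ae a)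
  have hpos : ∀ᵐ v ∂dilationMeasure, 0 < v :=
    (withDensity_absolutelyContinuous _ _).ae_le (ae_restrict_mem measurableSet_Ioi)
  have hint1 : Integrable (fun p : ℝ × ℝ =>
      a p.2 * ((‖waveletTransform k (f : Lp ℂ 2 (volume : Measure ℝ)) p‖ ^ 2 : ℝ) : ℂ)) haarG := by
    refine Integrable.bdd_mul (c := ‖a‖) ((memLp_waveletTransform k f).integrable_norm_pow two_ne_zero).ofReal
      (hm.comp measurable_snd).aestronglyMeasurable ?_
    exact Measure.quasiMeasurePreserving_snd.ae hbd
  have hint2 : Integrable (fun q : ℝ × ℝ => a q.1 *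
      ((‖φ q.2‖ ^ 2 * ‖kernelHat k 0 q.1 q.2‖ ^ 2 : ℝ) : ℂ)) (dilationMeasure.prod volume) := by
    refine Integrable.bdd_mul (c := ‖a‖) (integrable_fourier_kernelHat k f).ofReal
      (hm.comp measurable_fst).aestronglyMeasurable ?_
    exact Measure.quasiMeasurePreserving_fst.ae hbd
  calc _ = ∫ v, (∫ u, a v * ((‖waveletTransform k (f : Lp ℂ 2 (volume : Measure ℝ)) (u, v)‖ ^ 2 :
        ℝ) : ℂ)) ∂dilationMeasure := integral_prod_symm _ hint1
    _ = ∫ v, (∫ ξ, a v * ((‖φ ξ‖ ^ 2 * ‖kernelHat k 0 v ξ‖ ^ 2 : ℝ) : ℂ)) ∂dilationMeasure := by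
        refine integral_congr_ae ?_
        filter_upwards [hpos] with v hv
        rw [integral_const_mul, integral_const_mul, integral_complex_ofReal,
          integral_complex_ofReal, integral_waveletTransform_slice k _ hv]
    _ = ∫ ξ, (∫ v, a v * ((‖φ ξ‖ ^ 2 * ‖kernelHat k 0 v ξ‖ ^ 2 : ℝ) : ℂ) ∂dilationMeasure) :=
        integral_integral_swap hint2
    _ = ∫ ξ, (Ioi (0 : ℝ)).indicator (fun ξ => gammaFun k a ξ * ((‖φ ξ‖ ^ 2 : ℝ) : ℂ)) ξ := by
        refine integral_congr_ae ?_
        have h0 : ∀ᵐ ξ ∂(volume : Measure ℝ), ξ ≠ 0 := by simp [ae_iff]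
        filter_upwards [f.2, h0] with ξ h1 h2
        rcases lt_or_gt_of_ne h2 with h | h
        · rw [indicator_of_notMem (by simpa using h.le), hφ, h1 h]
          simp
        · rw [indicator_of_mem (by exact h), ← integral_kernelHat k a h, ← integral_mul_const]
          refine integral_congr_ae (.of_forall fun v => ?_)
          push_cast
          ring
    _ = _ := integral_indicator measurableSet_Ioi

theorem inner_verticalToeplitz (k : ℕ) (a : Lp ℂ ⊤ halfLine) (f : hardySpace) :
    inner ℂ (waveletIsometry k f) (verticalToeplitz k a (waveletIsometry k f)) =
      ∫ ξ in Ioi (0 : ℝ), gammaFun k a ξ * ((‖(𝓕 (f : Lp ℂ 2 (volume : Measure ℝ)) :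
        Lp ℂ 2 (volume : Measure ℝ)) ξ‖ ^ 2 : ℝ) : ℂ) := by
  -- The projection drops out because the left vector already lies in `A^{(k)}`.
  have e1 : inner ℂ (waveletIsometry k f) (verticalToeplitz k a (waveletIsometry k f)) =
      inner ℂ (waveletMap k f) (mulOp (verticalSymbol a) (waveletMap k f)) :=
    (waveletSpace k).inner_orthogonalProjectionOnto_eq_of_mem_left
      ((waveletMap k).rangeRestrict f) _
  rw [e1, ← integral_waveletTransform_sq, L2.inner_def]
  refine integral_congr_ae ?_
  filter_upwards [(ContinuousLinearMap.mul ℂ ℂ).coeFn_holder (r := 2) (verticalSymbol a)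
    (waveletMap k f), (memLp_comp_snd a).coeFn_toLp, (memLp_waveletTransform k f).coeFn_toLp]
    with p h1 h2 h3
  have h1' : mulOp (verticalSymbol a) (waveletMap k f) p = verticalSymbol a p * waveletMap k f p :=
    h1
  have h2' : verticalSymbol a p = a p.2 := h2
  have h3' : waveletMap k f p = waveletTransform k (f : Lp ℂ 2 (volume : Measure ℝ)) p := h3
  rw [h1', h2', h3', RCLike.inner_apply, mul_assoc, RCLike.mul_conj]
  push_cast
  rfl

/-- On a complex Hilbert space an operator is determined by its quadratic form, so comparing
diagonal values suffices. -/
theorem verticalToeplitz_eq (k : ℕ) (a : Lp ℂ ⊤ halfLine) (h : C(ℝ≥0∞, ℂ))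
    (hh : ∀ ξ, h ξ = gammaExt k a ξ) :
    (waveletUnitary k).conjStarAlgEquiv (mulCont h) = verticalToeplitz k a := by
  refine ContinuousLinearMap.coe_injective ((ext_inner_map _ _).1 fun x => ?_)
  obtain ⟨f, rfl⟩ := waveletIsometry_surjective k x
  -- `ext_inner_map` has the operator in the first slot, the computed form has it in the second.
  rw [← inner_conj_symm, ← inner_conj_symm (_ : WaveletHilbert k) (waveletIsometry k f)]
  congr 1
  rw [ContinuousLinearMap.coe_coe, ContinuousLinearMap.coe_coe, inner_verticalToeplitz,
    ← waveletUnitary_hardyFourier, LinearIsometryEquiv.conjStarAlgEquiv_apply_apply,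
    LinearIsometryEquiv.symm_apply_apply, LinearIsometryEquiv.inner_map_map, L2.inner_def]
  refine integral_congr_ae ?_
  filter_upwards [mulCont_coeFn h (hardyFourier f), hardyFourier_coeFn f,
    ae_restrict_mem measurableSet_Ioi] with ξ h1 h2 (h3 : 0 < ξ)
  rw [h1, h2, RCLike.inner_apply, mul_assoc, RCLike.mul_conj, hh, gammaExt,
    if_neg (by simpa using h3), if_neg ENNReal.ofReal_ne_top, ENNReal.toReal_ofReal h3.le]
  push_cast
  rfl

/-! ### The Toeplitz algebra -/

/-- The representation of `C[0, ∞]` on `A^{(k)}` that sends `γ_{a,k}` to `T_a^{(k)}`. -/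
noncomputable def contRep (k : ℕ) :
    C(ℝ≥0∞, ℂ) →⋆ₙₐ[ℂ] (WaveletHilbert k →L[ℂ] WaveletHilbert k) :=
  (NonUnitalStarAlgHomClass.toNonUnitalStarAlgHom (R := ℂ)
    (waveletUnitary k).conjStarAlgEquiv).comp mulContHom

/-- An injective `*`-homomorphism between `C*`-algebras is isometric. -/
theorem isometry_contRep (k : ℕ) : Isometry (contRep k) :=
  NonUnitalStarAlgHom.isometry _
    ((waveletUnitary k).conjStarAlgEquiv.injective.comp mulContHom_injective)

/-- `γ_{a,k}` as a continuous function on `[0, ∞]`. -/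
noncomputable def gammaCont (k : ℕ) {a : Lp ℂ ⊤ halfLine} (ha : a ∈ endpointLimits) :
    C(ℝ≥0∞, ℂ) :=
  ⟨gammaExt k a, continuous_gammaExt k ha⟩

theorem contRep_gammaCont (k : ℕ) {a : Lp ℂ ⊤ halfLine} (ha : a ∈ endpointLimits) :
    contRep k (gammaCont k ha) = verticalToeplitz k a :=
  verticalToeplitz_eq k a _ fun _ => rfl

/-- The range of an isometric `*`-homomorphism is a closed `*`-subalgebra, and it contains every
generator. -/
theorem toeplitzAlgebra_le_range (k : ℕ) {𝒜 : Submodule ℂ (Lp ℂ ⊤ halfLine)}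
    (h𝒜 : ∀ a ∈ 𝒜, a ∈ endpointLimits) :
    toeplitzAlgebra k 𝒜 ≤ NonUnitalStarAlgHom.range (contRep k) := by
  refine NonUnitalStarSubalgebra.topologicalClosure_minimal _ (NonUnitalStarAlgebra.adjoin_le ?_) ?_
  · rintro _ ⟨a, ha, rfl⟩
    exact ⟨_, contRep_gammaCont k (h𝒜 a ha)⟩
  · rw [NonUnitalStarAlgHom.coe_range]
    exact (isometry_contRep k).isClosedEmbedding.isClosed_range

/-- Stone–Weierstrass applied to the preimage of the Toeplitz algebra in `C[0, ∞]`, which is closed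
because `contRep` is continuous. -/
theorem contRep_mem_toeplitzAlgebra (k : ℕ) {𝒜 : Submodule ℂ (Lp ℂ ⊤ halfLine)}
    (h𝒜 : ∀ a ∈ 𝒜, a ∈ endpointLimits) (h1 : oneSymbol ∈ 𝒜)
    (hsep : ∀ ξ η : ℝ≥0∞, ξ ≠ η → ∃ a ∈ 𝒜, gammaExt k a ξ ≠ gammaExt k a η)
    (h : C(ℝ≥0∞, ℂ)) : contRep k h ∈ toeplitzAlgebra k 𝒜 := by
  have hmem : ∀ a (ha : a ∈ 𝒜),
      gammaCont k (h𝒜 a ha) ∈ (toeplitzAlgebra k 𝒜).comap (contRep k) := fun a ha => by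
    change contRep k _ ∈ toeplitzAlgebra k 𝒜
    rw [contRep_gammaCont]
    exact verticalToeplitz_mem k ha
  -- The Toeplitz algebra is generated without a unit; the constant `1` comes from the symbol `1`,
  -- as `γ_{1,k} = 1`.
  have hone : (1 : C(ℝ≥0∞, ℂ)) ∈ (toeplitzAlgebra k 𝒜).comap (contRep k) := by
    convert hmem _ h1
    ext ξ
    exact (gammaExt_oneSymbol k ξ).symm
  set S : StarSubalgebra ℂ C(ℝ≥0∞, ℂ) :=
    ((toeplitzAlgebra k 𝒜).comap (contRep k)).toStarSubalgebra hone
  have hS : S.SeparatesPoints := fun ξ η hne => by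
    obtain ⟨a, ha, hd⟩ := hsep ξ η hne
    exact ⟨_, ⟨_, hmem a ha, rfl⟩, hd⟩
  have hcl : IsClosed (S : Set C(ℝ≥0∞, ℂ)) :=
    (NonUnitalStarSubalgebra.isClosed_topologicalClosure _).preimage
      (isometry_contRep k).continuous
  have htop := ContinuousMap.starSubalgebra_topologicalClosure_eq_top_of_separatesPoints S hS
  have hle : S.topologicalClosure ≤ S := StarSubalgebra.topologicalClosure_minimal le_rfl hcl
  rw [htop] at hle
  exact hle (x := h) trivial

/-- The two inclusions make `contRep` a bijection onto the Toeplitz algebra, and `τ` is its inverse.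
The argument needs only that the symbols have endpoint limits, include `1` and have jointly
separating `γ`. -/
theorem exists_toeplitzAlgebra_equiv (k : ℕ) {𝒜 : Submodule ℂ (Lp ℂ ⊤ halfLine)}
    (h𝒜 : ∀ a ∈ 𝒜, a ∈ endpointLimits) (h1 : oneSymbol ∈ 𝒜)
    (hsep : ∀ ξ η : ℝ≥0∞, ξ ≠ η → ∃ a ∈ 𝒜, gammaExt k a ξ ≠ gammaExt k a η) :
    ∃ τ : toeplitzAlgebra k 𝒜 ≃⋆ₐ[ℂ] C(ℝ≥0∞, ℂ),
      Isometry τ ∧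
      ∀ (a : Lp ℂ ⊤ halfLine) (ha : a ∈ 𝒜) (ξ : ℝ≥0∞),
        τ ⟨verticalToeplitz k a, verticalToeplitz_mem k ha⟩ ξ = gammaExt k a ξ := by
  set ρ : C(ℝ≥0∞, ℂ) →⋆ₙₐ[ℂ] toeplitzAlgebra k 𝒜 :=
    NonUnitalStarAlgHom.codRestrict (contRep k) _ (contRep_mem_toeplitzAlgebra k h𝒜 h1 hsep)
  have hρ : Function.Bijective ρ := by
    refine ⟨fun x y hxy => (isometry_contRep k).injective (congrArg Subtype.val hxy), ?_⟩
    rintro ⟨x, hx⟩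
    obtain ⟨h, rfl⟩ := toeplitzAlgebra_le_range k h𝒜 hx
    exact ⟨h, rfl⟩
  have hiso : Isometry ρ := fun x y => isometry_contRep k x y
  set σ := StarAlgEquiv.ofBijective (R := ℂ) ρ hρ
  refine ⟨σ.symm, hiso.right_inv σ.apply_symm_apply, fun a ha ξ => ?_⟩
  have : (⟨verticalToeplitz k a, verticalToeplitz_mem k ha⟩ : toeplitzAlgebra k 𝒜) =
      σ (gammaCont k (h𝒜 a ha)) := Subtype.ext (contRep_gammaCont k (h𝒜 a ha)).symm
  rw [this, StarAlgEquiv.symm_apply_apply]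
  rfl

end CalderonToeplitz

theorem mainTheorem4 (k : ℕ) (a₁ : Lp ℂ ⊤ halfLine) (ha₁ : a₁ ∈ endpointLimits)
    (hreal : ∀ᵐ v ∂halfLine, (a₁ v).im = 0)
    (hsep : ∀ ξ η : ℝ≥0∞, ξ ≠ η → gammaExt k a₁ ξ ≠ gammaExt k a₁ η) :
    ∃ τ : toeplitzAlgebra k (spanOne a₁) ≃⋆ₐ[ℂ] C(ℝ≥0∞, ℂ),
      Isometry τ ∧
      ∀ (a : Lp ℂ ⊤ halfLine) (ha : a ∈ spanOne a₁) (ξ : ℝ≥0∞),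
        τ ⟨verticalToeplitz k a, verticalToeplitz_mem k ha⟩ ξ = gammaExt k a ξ :=
  exists_toeplitzAlgebra_equiv k (fun _ => spanOne_subset_endpointLimits ha₁)
    (Submodule.subset_span (by simp)) fun ξ η hne =>
      ⟨a₁, Submodule.subset_span (by simp), hsep ξ η hne⟩
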